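/- Let $H$ be a separable real Hilbert space. For a probability space $(S,\mu)$, let $L^0(S,\mu)$ be the space of $\mu$-equivalence classes of real measurable functions with the topology of convergence in measure. A generalized $H$-valued function on $(S,\mu)$ is a continuous linear operator $Y:H\to L^0(S,\mu)$, written $\xi\mapsto\langle Y,\xi\rangle$. Its law is the joint law of all $\langle Y,\xi\rangle$, $\xi\in H$. Let $(\Omega,P)$ and $(\mathcal T,\mu)$ be standard Borel probability spaces. Let $X$ be a standard Gaussian in $H$, that is, a generalized $H$-valued function on $(\Omega,P)$ such that $\langle X,\xi\rangle\sim N(0,\|\xi\|^2)$ for all $\xi\in H$. Let $Y$ be a generalized $H$-valued function on $(\mathcal T,\mu)$. Assume that one of the following holds. (a) $Y$ is a randomized shift: $\mathrm{Law}_{P\otimes\mu}[X+Y]\ll\mathrm{Law}_P[X]$. (b) There is a subcritical Gaussian multiplicative chaos $M$ over $(X,Y)$ whose expectation $E M$ is equivalent to $\mu$ (for instance $E M=\mu$). That is, $M=M(X)$ is an a.s. finite random measure on $\mathcal T$, a measurable function of $X$, such that $E M$ is $\sigma$-finite and equivalent to $\mu$, and for every $\xi\in H$, almost surely, $M(X+\xi,dt)=e^{\langle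 Y(t),\xi\rangle}M(X,dt)$. For a measure $\nu$ equivalent to $\mu$ and $n\in\mathbb N$ consider the following two properties. $(\mathrm M_n)$ Under $\nu$ all $\langle Y,\xi\rangle$ have finite absolute $n$-th moment, and the symmetric tensor $E_\nu Y^{\otimes n}$, i.e. the $n$-linear form $(\xi_1,\dots,\xi_n)\mapsto\int\prod_i\langle Y,\xi_i\rangle\,d\nu$, is Hilbert–Schmidt. $(\mathrm K_n)$ For every $f\in L^2(\nu)$ the weak integral $\int fY\,d\nu\in H$ exists and depends boundedly and linearly on $f$. The quadratic form $f\mapsto\|\int fY\,d\nu\|^2$ on $L^2(\nu)$ is Hilbert–Schmidt. There is a unique symmetric $K\in L^2(\nu\otimes\nu)$ with $$\Big\|\int f(t)Y(t)\,\nu(dt)\Big\|^2=\int K(t,s)f(t)f(s)\,\nu(dt)\,\nu(ds)\qquad\text{for all } f\in L^2(\nu),$$ and $K^n$ is $\nu\otimes\nu$-integrable. Then for every $n\in\mathbb N$ there is a probability measure $\mu_n'$ equivalent to $\mu$ for which both $(\mathrm M_n)$ and $(\mathrm K_n)$ hold. Moreover, if $n\ge2$ is even, then every finite measure $\nu$ equivalent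 to $\mu$ that satisfies $(\mathrm M_n)$ also satisfies $(\mathrm K_n)$. -/

import Mathlib

open MeasureTheory ProbabilityTheory Filter Topology
open scoped ENNReal

noncomputable section

namespace GMC

universe u

/-- A generalized `H`-valued function on `(S, μ)`: a linear operator `H → L⁰(S, μ)` which is
continuous when `L⁰(S, μ)` carries the topology of convergence in measure. -/
structure GenFun (H : Type*) [NormedAddCommGroup H] [InnerProductSpace ℝ H]
    {S : Type*} [MeasurableSpace S] (μ : Measure S) where
  /-- `ξ ↦ ⟨Y, ξ⟩`. -/
  op : H →ₗ[ℝ] (S →ₘ[μ] ℝ)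
  continuous_in_measure :
    ∀ ξ : H, TendstoInMeasure μ (fun (η : H) (s : S) => op η s) (𝓝 ξ) (fun s => op ξ s)

section Setup

variable {H : Type*} [NormedAddCommGroup H] [InnerProductSpace ℝ H]
variable {S : Type*} [MeasurableSpace S] {μ : Measure S}

/-- `Y.pair ξ s` is `⟨Y(s), ξ⟩`, through a measurable representative of the class `⟨Y, ξ⟩`. -/
def GenFun.pair (Y : GenFun H μ) (ξ : H) (s : S) : ℝ := Y.op ξ s

/-- The "value" of a generalized function at a point: the family of all its pairings. Spaces of
such families carry the product `σ`-algebra of `H → ℝ`. -/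
def GenFun.val (Y : GenFun H μ) (s : S) : H → ℝ := fun ξ => Y.pair ξ s

/-- The measurable representatives are measurable. -/
theorem GenFun.measurable_pair (Y : GenFun H μ) (ξ : H) : Measurable (Y.pair ξ) :=
  (Y.op ξ).measurable

/-- The family of pairings is measurable for the product `σ`-algebra. -/
theorem GenFun.measurable_val (Y : GenFun H μ) : Measurable Y.val :=
  measurable_pi_iff.mpr fun ξ => Y.measurable_pair ξ

/-- `X` is standard Gaussian in `H`: every `⟨X, ξ⟩` is centered Gaussian of variance `‖ξ‖²`. -/
def IsStandardGaussian (X : GenFun H μ) : Prop :=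
  ∀ ξ : H, μ.map (X.pair ξ) = gaussianReal 0 (‖ξ‖₊ ^ 2)

variable {Ω : Type*} [MeasurableSpace Ω] {P : Measure Ω}
variable {T : Type*} [MeasurableSpace T] {ρ : Measure T}

/-- `Y` is a randomized shift of `X`: the law of `X + Y` under `P ⊗ ρ` is absolutely continuous
with respect to the law of `X` under `P`. The law is the joint law of all linear functionals. -/
def IsRandomizedShift (X : GenFun H P) (Y : GenFun H ρ) : Prop :=
  (P.prod ρ).map (fun p : Ω × T => X.val p.1 + Y.val p.2) ≪ P.map X.val

/-- The expectation `E M` of the random measure `M(X)`: `(E M)[A] = E (M(X)[A])`. -/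
def expectedMeasure (X : GenFun H P) (M : Kernel (H → ℝ) T) : Measure T :=
  P.bind fun ω => M (X.val ω)

/-- `M` is a Gaussian multiplicative chaos over `(X, Y)`. The random measure is `ω ↦ M (X ω)`, a
measurable function of `X`; the shifted field `X + ξ` has pairings `⟨X, η⟩ + ⟨ξ, η⟩`. -/
structure IsChaos (X : GenFun H P) (Y : GenFun H ρ) (M : Kernel (H → ℝ) T) : Prop where
  finite : ∀ᵐ ω ∂P, IsFiniteMeasure (M (X.val ω))
  expected_ac : expectedMeasure X M ≪ ρ
  shift : ∀ ξ : H, ∀ᵐ ω ∂P,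
    M (X.val ω + fun η => inner ℝ ξ η) =
      (M (X.val ω)).withDensity fun t => ENNReal.ofReal (Real.exp (Y.pair ξ t))

/-- A chaos is subcritical if its expectation is `σ`-finite. -/
structure IsSubcriticalChaos (X : GenFun H P) (Y : GenFun H ρ) (M : Kernel (H → ℝ) T) : Prop
    extends IsChaos X Y M where
  sigmaFinite : SigmaFinite (expectedMeasure X M)

end Setup

section HilbertSchmidt

variable {E : Type u} [NormedAddCommGroup E] [InnerProductSpace ℝ E]

/-- A bounded `n`-linear form on a Hilbert space is Hilbert–Schmidt (that is, given by a tensor in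
the Hilbert tensor power) if its coefficients in orthonormal bases are square summable. -/
def IsHilbertSchmidtTensor {n : ℕ} (τ : ContinuousMultilinearMap ℝ (fun _ : Fin n => E) ℝ) :
    Prop :=
  ∀ (ι : Type u) (b : HilbertBasis ι ℝ E),
    Summable fun s : Fin n → ι => τ (fun k => b (s k)) ^ 2

/-- `q` is a bounded quadratic form whose symmetric bilinear form is Hilbert–Schmidt. -/
def IsHilbertSchmidtQuadraticForm (q : E → ℝ) : Prop :=
  ∃ B : E →L[ℝ] E →L[ℝ] ℝ, (∀ x y, B x y = B y x) ∧ (∀ x, q x = B x x) ∧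
    ∀ (ι : Type u) (b : HilbertBasis ι ℝ E),
      Summable fun p : ι × ι => B (b p.1) (b p.2) ^ 2

end HilbertSchmidt

section Moments

variable {H : Type*} [NormedAddCommGroup H] [InnerProductSpace ℝ H]
variable {T : Type*} [MeasurableSpace T] {μ : Measure T}

/-- Under `ν` all `⟨Y, ξ⟩` have finite absolute `n`-th moment and the symmetric tensor
`E_ν Y^{⊗ n}`, whose diagonal is `ξ ↦ E_ν ⟨Y, ξ⟩ ^ n`, is Hilbert–Schmidt. -/
def HasHilbertSchmidtMoment (Y : GenFun H μ) (ν : Measure T) (n : ℕ) : Prop :=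
  (∀ ξ : H, Integrable (fun t => |Y.pair ξ t| ^ n) ν) ∧
  ∃ τ : ContinuousMultilinearMap ℝ (fun _ : Fin n => H) ℝ,
    (∀ ξ : Fin n → H, τ ξ = ∫ t, ∏ k, Y.pair (ξ k) t ∂ν) ∧ IsHilbertSchmidtTensor τ

/-- `v = ∫ f Y dν` as a weak integral in `H`. -/
def IsWeakIntegral (Y : GenFun H μ) (ν : Measure T) (f : T → ℝ) (v : H) : Prop :=
  ∀ ξ : H, Integrable (fun t => f t * Y.pair ξ t) ν ∧
    inner ℝ v ξ = ∫ t, f t * Y.pair ξ t ∂ν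

/-- `K` is a symmetric kernel of the quadratic form `q` on `L²(ν)`. -/
def IsSymmetricKernelOf {ν : Measure T} (q : Lp ℝ 2 ν → ℝ) (K : Lp ℝ 2 (ν.prod ν)) : Prop :=
  (∀ᵐ p ∂(ν.prod ν), K p.swap = K p) ∧
  ∀ f : Lp ℝ 2 ν, q f = ∫ p, K p * f p.1 * f p.2 ∂(ν.prod ν)

/-- The weak integrals `A f = ∫ f Y dν`, `f ∈ L²(ν)`, exist and depend boundedly on `f`, the form
`f ↦ ‖∫ f Y dν‖²` is Hilbert–Schmidt, it has exactly one symmetric kernel `K ∈ L²(ν ⊗ ν)`, and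
`K ^ n` is `ν ⊗ ν`-integrable. -/
def HasCovarianceKernel (Y : GenFun H μ) (ν : Measure T) (n : ℕ) : Prop :=
  ∃ A : Lp ℝ 2 ν →L[ℝ] H, (∀ f : Lp ℝ 2 ν, IsWeakIntegral Y ν f (A f)) ∧
    IsHilbertSchmidtQuadraticForm (fun f : Lp ℝ 2 ν => ‖A f‖ ^ 2) ∧
    ∃ K : Lp ℝ 2 (ν.prod ν),
      IsSymmetricKernelOf (fun f : Lp ℝ 2 ν => ‖A f‖ ^ 2) K ∧
      (∀ K' : Lp ℝ 2 (ν.prod ν),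
        IsSymmetricKernelOf (fun f : Lp ℝ 2 ν => ‖A f‖ ^ 2) K' → K' = K) ∧
      Integrable (fun p => K p ^ n) (ν.prod ν)

end Moments

end GMC

end

/-! Write `y_i = ⟨Y, b_i⟩` for an orthonormal basis `b`. Formally the kernel is `K(t,s) = ∑ y_i(t)
y_i(s)`, and expanding the power gives `∫ K^n d(ν⊗ν) = ∑_s (∫ ∏_k y_{s k} dν)²`, the squared
Hilbert–Schmidt norm of `E_ν Y^{⊗n}`; `sum_sq_integral_prod_eq` is this identity for partial sums.
Hence a single even degree `N ≥ 2` suffices: `|x|^n ≤ 1 + x^N` descends to all `n ≤ N`, degree 2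
makes the series for `K` converge in `L²`, and Fatou's lemma bounds `∫ K^N`
(`hasCovarianceKernel_of_moments`). This settles the claim for even `n`; the existence claim uses
degree `2n + 2`.

It remains to find `ν` equivalent to `μ` with square summable moments of degree `N`. The key is
tightness (`IsStandard.tight_of_shift`): if `X + Y ≪ X`, the polynomials `∑ a_s ∏_k y_{s k}` with `∑
a_s² ≤ 1` are uniformly tight. Replacing the empirical mean of `N` independent copies of `X` by an
independent `X/√N` does not change their law, so shifting all copies by `Y/√N` is absolutely
continuous. The decoupled polynomial `∑ a_s ∏_j x_j(s_j)` has second moment `∑ a_s²`, so it stays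
tight after the shift, and averaging over the signs of the copies isolates the polynomial in `Y`.

Tightness provides, for each unit combination `f`, a weight `h(f)` with `f h(f) ≤ 1`, taken from one
closed convex set of almost everywhere positive weights. The minimax argument
`exists_summable_sq_inner` turns these into one weight for which all moments are jointly square
summable (`exists_weight_summable_sq`).

For a chaos, the Cameron–Martin formula and Laplace transforms show that choosing `t` under a finite
density of `E M` and adding `Y(t)` to `X` amounts to reweighting `P` by the corresponding mass of
`M`. So, after a change to an equivalent finite measure, `Y` is again a randomized shift
(`exists_equivalent_shift`). -/

namespace GMC

/-! ### Convex sets in Hilbert space and a minimax principle -/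

section ConvexHilbert

variable {E : Type*} [NormedAddCommGroup E] [InnerProductSpace ℝ E] [CompleteSpace E]

/-- A nonempty closed convex set has an element of minimal norm. -/
theorem exists_sq_norm_le_inner {K : Set E} (hne : K.Nonempty) (hcl : IsClosed K)
    (hcv : Convex ℝ K) : ∃ v ∈ K, ∀ w ∈ K, ‖v‖ ^ 2 ≤ inner ℝ v w := by
  obtain ⟨v, hv, h⟩ := exists_norm_eq_iInf_of_complete_convex hne hcl.isComplete hcv 0
  refine ⟨v, hv, fun w hw => ?_⟩
  have := (norm_eq_iInf_iff_real_inner_le_zero hcv hv).1 h w hw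
  rw [zero_sub, inner_neg_left, inner_sub_right, real_inner_self_eq_norm_sq] at this
  linarith

/-- A decreasing sequence of nonempty closed convex sets which meet a fixed ball has nonempty
intersection. -/
theorem nonempty_iInter_of_isClosed_convex {C : ℕ → Set E} (hanti : Antitone C)
    (hcl : ∀ k, IsClosed (C k)) (hcv : ∀ k, Convex ℝ (C k)) {B : ℝ}
    (hB : ∀ k, ∃ x ∈ C k, ‖x‖ ≤ B) : ∃ x, ∀ k, x ∈ C k := by
  have hne : ∀ k, (C k).Nonempty := fun k => let ⟨x, hx, _⟩ := hB k; ⟨x, hx⟩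
  -- The least-norm points `p k` have increasing bounded norms, and the variational inequality
  -- bounds `‖p l - p k‖²` by the increment of the squared norms, so they form a Cauchy sequence.
  choose p hp hmin using fun k => exists_sq_norm_le_inner (hne k) (hcl k) (hcv k)
  have hle : ∀ k l, k ≤ l → ‖p l - p k‖ ^ 2 ≤ ‖p l‖ ^ 2 - ‖p k‖ ^ 2 := by
    intro k l hkl
    have h1 := hmin k (p l) (hanti hkl (hp l))
    rw [norm_sub_sq_real, real_inner_comm]
    linarith
  have hmono : Monotone fun k => ‖p k‖ ^ 2 := fun k l hkl => by
    have := hle k l hkl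
    have h2 := sq_nonneg ‖p l - p k‖
    simp only
    linarith
  have hbdd : BddAbove (Set.range fun k => ‖p k‖ ^ 2) := by
    refine ⟨B ^ 2, ?_⟩
    rintro _ ⟨k, rfl⟩
    obtain ⟨x, hx, hxB⟩ := hB k
    have h1 := hmin k x hx
    have h2 := real_inner_le_norm (p k) x
    have h3 : ‖p k‖ ≤ ‖x‖ := by
      by_contra! h
      nlinarith [norm_nonneg x]
    exact pow_le_pow_left₀ (norm_nonneg _) (h3.trans hxB) 2
  have hcau : CauchySeq fun k => ‖p k‖ ^ 2 := (tendsto_atTop_ciSup hmono hbdd).cauchySeq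
  have hp' : CauchySeq p := by
    rw [Metric.cauchySeq_iff'] at hcau ⊢
    intro ε hε
    obtain ⟨K, hK⟩ := hcau (ε ^ 2) (by positivity)
    refine ⟨K, fun l hl => ?_⟩
    have h1 := hK l hl
    rw [Real.dist_eq] at h1
    rw [dist_eq_norm]
    have h2 := hle K l hl
    have h3 := (le_abs_self _).trans_lt h1
    exact lt_of_pow_lt_pow_left₀ 2 hε.le (h2.trans_lt h3)
  obtain ⟨x, hx⟩ := cauchySeq_tendsto_of_complete hp'
  refine ⟨x, fun k => (hcl k).mem_of_tendsto hx ?_⟩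
  filter_upwards [eventually_ge_atTop k] with l hl using hanti hl (hp l)

/-- A minimax principle: if every unit combination of the functionals `⟨φ s, ·⟩` is at most `D`
somewhere on `W`, then all functionals are jointly square summable at some point of `W`. -/
theorem exists_summable_sq_inner {S : Type*} [Countable S] {W : Set E} (hcl : IsClosed W)
    (hcv : Convex ℝ W) {B : ℝ} (hB : ∀ x ∈ W, ‖x‖ ≤ B) (φ : S → E) {D : ℝ}
    (hD : ∀ (G : Finset S) (a : S → ℝ), ∑ s ∈ G, a s ^ 2 ≤ 1 →
      ∃ w ∈ W, inner ℝ (∑ s ∈ G, a s • φ s) w ≤ D) :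
    ∃ w ∈ W, Summable fun s => inner ℝ (φ s) w ^ 2 := by
  classical
  have hD0 : ∀ G : Finset S, ∃ w ∈ W, ∑ s ∈ G, inner ℝ (φ s) w ^ 2 ≤ (|D| + 1) ^ 2 := by
    intro G
    let L : E →ₗ[ℝ] EuclideanSpace ℝ G :=
      { toFun := fun w => WithLp.toLp 2 fun s : G => inner ℝ (φ s) w
        map_add' := fun x y => by ext s; simp [inner_add_right]
        map_smul' := fun c x => by ext s; simp [inner_smul_right] }
    -- Let `v` be the least-norm point of the closure of the image of `W` in `ℝ^G`. Testing the
    -- hypothesis with the unit vector `v / ‖v‖` gives `‖v‖² ≤ ⟨v, L w⟩ ≤ ‖v‖ D`.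
    obtain ⟨w0, hw0, -⟩ := hD ∅ 0 (by simp)
    obtain ⟨v, hv, hmin⟩ := exists_sq_norm_le_inner (K := closure (L '' W))
      (Set.Nonempty.closure ⟨_, w0, hw0, rfl⟩) isClosed_closure (hcv.linear_image L).closure
    have hvD : ‖v‖ ≤ |D| := by
      rcases eq_or_ne v 0 with rfl | hv0
      · simp
      have hpos : 0 < ‖v‖ := norm_pos_iff.2 hv0
      let a : S → ℝ := fun s => if h : s ∈ G then v ⟨s, h⟩ / ‖v‖ else 0
      have ha : ∀ s : G, a s = v s / ‖v‖ := fun s => by simp [a]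
      obtain ⟨w, hw, hwD⟩ := hD G a (by
        rw [← Finset.sum_coe_sort]
        simp_rw [ha, div_pow]
        rw [← Finset.sum_div, ← EuclideanSpace.real_norm_sq_eq]
        exact div_self_le_one _)
      have h1 := hmin (L w) (subset_closure ⟨w, hw, rfl⟩)
      have h2 : inner ℝ v (L w) = ‖v‖ * inner ℝ (∑ s ∈ G, a s • φ s) w := by
        rw [sum_inner, ← Finset.sum_coe_sort, Finset.mul_sum, PiLp.inner_apply]
        refine Finset.sum_congr rfl fun s _ => ?_
        rw [ha, real_inner_smul_left]
        simp only [L, LinearMap.coe_mk, AddHom.coe_mk, RCLike.inner_apply, conj_trivial]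
        field_simp
      rw [h2, pow_two] at h1
      exact (le_of_mul_le_mul_left h1 hpos).trans (hwD.trans (le_abs_self _))
    -- The point `v` is only in the closure; the `+ 1` in the bound pays for approximating it from
    -- the image.
    obtain ⟨_, ⟨w, hw, rfl⟩, hvw⟩ := Metric.mem_closure_iff.1 hv 1 one_pos
    refine ⟨w, hw, ?_⟩
    have h3 : ‖L w‖ ≤ |D| + 1 := by
      have := norm_sub_norm_le (L w) v
      rw [← dist_eq_norm, dist_comm] at this
      linarith
    calc ∑ s ∈ G, inner ℝ (φ s) w ^ 2 = ‖L w‖ ^ 2 := by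
          rw [EuclideanSpace.real_norm_sq_eq, ← Finset.sum_coe_sort]; rfl
      _ ≤ _ := pow_le_pow_left₀ (norm_nonneg _) h3 2
  obtain ⟨G, hGmono, hG⟩ := exists_seq_monotone_tendsto_atTop_atTop (Finset S)
  let C : ℕ → Set E := fun k => W ∩ {w | ∑ s ∈ G k, inner ℝ (φ s) w ^ 2 ≤ (|D| + 1) ^ 2}
  obtain ⟨w, hw⟩ := nonempty_iInter_of_isClosed_convex (C := C) (B := B)
    (fun k l hkl w hw => ⟨hw.1, le_trans (Finset.sum_le_sum_of_subset_of_nonneg (hGmono hkl)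
      fun s _ _ => sq_nonneg (inner ℝ (φ s) w)) hw.2⟩)
    (fun k => hcl.inter (isClosed_le (by fun_prop) continuous_const))
    (fun k => by
      refine hcv.inter ?_
      have : ConvexOn ℝ Set.univ fun w : E => ∑ s ∈ G k, inner ℝ (φ s) w ^ 2 := by
        refine ⟨convex_univ, fun x _ y _ a b ha hb hab => ?_⟩
        simp only [smul_eq_mul, Finset.mul_sum]
        rw [← Finset.sum_add_distrib]
        refine Finset.sum_le_sum fun s _ => ?_
        rw [inner_add_right, inner_smul_right, inner_smul_right]
        obtain rfl : b = 1 - a := by linarith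
        nlinarith [mul_nonneg (mul_nonneg ha hb)
          (sq_nonneg (inner ℝ (φ s) x - inner ℝ (φ s) y))]
      simpa using this.convex_le ((|D| + 1) ^ 2))
    (fun k => by
      obtain ⟨w, hw, h⟩ := hD0 (G k)
      exact ⟨w, ⟨hw, h⟩, hB w hw⟩)
  refine ⟨w, (hw 0).1, summable_of_sum_le (c := (|D| + 1) ^ 2) (fun _ => sq_nonneg _) fun F => ?_⟩
  obtain ⟨k, hk⟩ := (tendsto_atTop.1 hG F).exists
  exact (Finset.sum_le_sum_of_subset_of_nonneg hk fun _ _ _ => sq_nonneg _).trans (hw k).2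

end ConvexHilbert

/-! ### Construction of densities -/

section Weights

variable {T : Type*} [MeasurableSpace T] {m : Measure T}

/-- For levels `R j ≥ 1` there is a decreasing function bounded by `1` and by the inverse, which
is at least `2⁻¹ ^ (j + 1) / R j` below `R j`. -/
theorem exists_antitone_weight {R : ℕ → ℝ} (hR : ∀ j, 1 ≤ R j) :
    ∃ h : ℝ → ℝ, Antitone h ∧ (∀ r, 0 ≤ h r) ∧ (∀ r, h r ≤ 1) ∧ (∀ r, r * h r ≤ 1) ∧
      ∀ j r, r ≤ R j → (1 / 2 : ℝ) ^ (j + 1) / R j ≤ h r := by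
  set c : ℕ → ℝ := fun j => (1 / 2 : ℝ) ^ (j + 1) / R j with hc
  have hR0 : ∀ j, 0 < R j := fun j => one_pos.trans_le (hR j)
  have hc0 : ∀ j, 0 < c j := fun j => by have := hR0 j; positivity
  have hgeom : HasSum (fun j : ℕ => (1 / 2 : ℝ) ^ (j + 1)) 1 := by
    simpa [pow_succ] using hasSum_geometric_two.mul_right (1 / 2 : ℝ)
  have hcle : ∀ j, c j ≤ (1 / 2 : ℝ) ^ (j + 1) := fun j => div_le_self (by positivity) (hR j)
  -- The function is `h = ∑_j c_j 1_{r ≤ R j}`; wherever a term is nonzero, `r c_j ≤ R_j c_j =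
  -- 2^{-(j+1)}`, and these sum to 1.
  let g : ℝ → ℕ → ℝ := fun r j => if r ≤ R j then c j else 0
  have hg0 : ∀ r j, 0 ≤ g r j := fun r j => by
    simp only [g]; split_ifs
    exacts [(hc0 j).le, le_rfl]
  have hgle : ∀ r j, g r j ≤ (1 / 2 : ℝ) ^ (j + 1) := fun r j => by
    simp only [g]; split_ifs
    exacts [hcle j, by positivity]
  have hgs : ∀ r, Summable (g r) := fun r =>
    Summable.of_nonneg_of_le (hg0 r) (hgle r) hgeom.summable
  refine ⟨fun r => ∑' j, g r j, ?_, fun r => tsum_nonneg (hg0 r), fun r => ?_, fun r => ?_, ?_⟩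
  · intro r r' hrr
    refine (hgs r').tsum_le_tsum (fun j => ?_) (hgs r)
    simp only [g]
    split_ifs with h1 h2
    exacts [le_rfl, absurd (hrr.trans h1) h2, (hc0 j).le, le_rfl]
  · exact ((hgs r).tsum_le_tsum (hgle r) hgeom.summable).trans hgeom.tsum_eq.le
  · rw [← tsum_mul_left]
    refine (((hgs r).mul_left r).tsum_le_tsum (fun j => ?_) hgeom.summable).trans hgeom.tsum_eq.le
    simp only [g]
    split_ifs with h1
    · calc r * c j ≤ R j * c j := mul_le_mul_of_nonneg_right h1 (hc0 j).le
        _ = _ := by simp only [hc]; field_simp [(hR0 j).ne']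
    · simp
  · intro j r hr
    refine le_trans ?_ ((hgs r).le_tsum j fun i _ => hg0 r i)
    simp [g, hr, hc]

/-- The weights between `0` and `1` whose deficits below the levels `c j` are controlled. -/
def weightSet (m : Measure T) (c : ℕ → ℝ) : Set (Lp ℝ 2 m) :=
  {w | (∀ᵐ t ∂m, 0 ≤ w t ∧ w t ≤ 1) ∧
    ∀ j, ∫⁻ t, ENNReal.ofReal (c j - w t) ∂m ≤ ENNReal.ofReal (c j) * (1 / 4) ^ j}

/-- An `L²` limit is an almost everywhere limit along a subsequence, and Fatou's lemma preserves the
deficit bounds. -/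
theorem isClosed_weightSet (c : ℕ → ℝ) : IsClosed (weightSet m c) := by
  refine IsSeqClosed.isClosed fun u w hu hw => ?_
  obtain ⟨ns, -, hns⟩ := (tendstoInMeasure_of_tendsto_Lp hw).exists_seq_tendsto_ae
  refine ⟨?_, fun j => ?_⟩
  · filter_upwards [hns, ae_all_iff.2 fun k => (hu k).1] with t ht h01
    exact ⟨ge_of_tendsto' ht fun k => (h01 _).1, le_of_tendsto' ht fun k => (h01 _).2⟩
  · calc ∫⁻ t, ENNReal.ofReal (c j - w t) ∂m
        = ∫⁻ t, liminf (fun k => ENNReal.ofReal (c j - u (ns k) t)) atTop ∂m := by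
          refine lintegral_congr_ae ?_
          filter_upwards [hns] with t ht
          exact ((ENNReal.continuous_ofReal.tendsto _).comp (ht.const_sub (c j))).liminf_eq.symm
      _ ≤ liminf (fun k => ∫⁻ t, ENNReal.ofReal (c j - u (ns k) t) ∂m) atTop :=
          lintegral_liminf_le fun k =>
            (measurable_const.sub (Lp.stronglyMeasurable _).measurable).ennreal_ofReal
      _ ≤ _ := by
          refine liminf_le_of_frequently_le' (Frequently.of_forall fun k => ?_)
          exact (hu _).2 j

theorem convex_weightSet (c : ℕ → ℝ) : Convex ℝ (weightSet m c) := by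
  intro u hu w hw a b ha hb hab
  have hcoe : ∀ᵐ t ∂m, (a • u + b • w : Lp ℝ 2 m) t = a * u t + b * w t := by
    filter_upwards [Lp.coeFn_add (a • u) (b • w), Lp.coeFn_smul a u, Lp.coeFn_smul b w]
      with t h1 h2 h3
    rw [h1, Pi.add_apply, h2, h3, Pi.smul_apply, Pi.smul_apply, smul_eq_mul, smul_eq_mul]
  refine ⟨?_, fun j => ?_⟩
  · filter_upwards [hcoe, hu.1, hw.1] with t h hu hw
    rw [h]
    exact ⟨by nlinarith [mul_nonneg ha hu.1, mul_nonneg hb hw.1],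
      by nlinarith [mul_le_mul_of_nonneg_left hu.2 ha, mul_le_mul_of_nonneg_left hw.2 hb]⟩
  · have hmeas : ∀ u : Lp ℝ 2 m, Measurable fun t => ENNReal.ofReal (c j - u t) := fun u =>
      (measurable_const.sub (Lp.stronglyMeasurable _).measurable).ennreal_ofReal
    calc ∫⁻ t, ENNReal.ofReal (c j - (a • u + b • w : Lp ℝ 2 m) t) ∂m
        ≤ ∫⁻ t, (ENNReal.ofReal a * ENNReal.ofReal (c j - u t)
            + ENNReal.ofReal b * ENNReal.ofReal (c j - w t)) ∂m := by
          refine lintegral_mono_ae ?_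
          filter_upwards [hcoe] with t h
          rw [h, ← ENNReal.ofReal_mul ha, ← ENNReal.ofReal_mul hb]
          refine le_trans (le_of_eq ?_) ENNReal.ofReal_add_le
          congr 1
          linear_combination (-c j) * hab
      _ = ENNReal.ofReal a * ∫⁻ t, ENNReal.ofReal (c j - u t) ∂m
            + ENNReal.ofReal b * ∫⁻ t, ENNReal.ofReal (c j - w t) ∂m := by
          rw [lintegral_add_left ((hmeas u).const_mul _), lintegral_const_mul _ (hmeas u),
            lintegral_const_mul _ (hmeas w)]
      _ ≤ ENNReal.ofReal a * (ENNReal.ofReal (c j) * (1 / 4) ^ j)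
            + ENNReal.ofReal b * (ENNReal.ofReal (c j) * (1 / 4) ^ j) := by
          gcongr
          exacts [hu.2 j, hw.2 j]
      _ = _ := by
          rw [← add_mul, ← ENNReal.ofReal_add ha hb, hab, ENNReal.ofReal_one, one_mul]

/-- Where `w ≤ 0` the deficit below `c j` is at least `c j`, so Markov's inequality bounds the
measure of that set by `4^{-j}` for every `j`. -/
theorem ae_pos_of_mem_weightSet {c : ℕ → ℝ} (hc : ∀ j, 0 < c j) {w : Lp ℝ 2 m}
    (hw : w ∈ weightSet m c) : ∀ᵐ t ∂m, 0 < w t := by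
  have hle : ∀ j, m {t | ¬ 0 < w t} ≤ (1 / 4) ^ j := by
    intro j
    have h1 : ENNReal.ofReal (c j) * m {t | ¬ 0 < w t} ≤ ENNReal.ofReal (c j) * (1 / 4) ^ j := by
      refine le_trans ?_ (hw.2 j)
      refine le_trans ?_ (mul_meas_ge_le_lintegral₀
        (measurable_const.sub (Lp.stronglyMeasurable w).measurable).ennreal_ofReal.aemeasurable
          (ENNReal.ofReal (c j)))
      refine mul_le_mul_right (measure_mono fun t (h : ¬ 0 < w t) => ENNReal.ofReal_le_ofReal ?_) _
      simp only [Pi.sub_apply]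
      linarith
    exact (ENNReal.mul_le_mul_iff_right (by simpa using hc j) ENNReal.ofReal_ne_top).1 h1
  refine le_antisymm (ge_of_tendsto' (ENNReal.tendsto_pow_atTop_nhds_zero_of_lt_one ?_) hle)
    zero_le
  rw [one_div]
  exact ENNReal.inv_lt_one.2 (by norm_num)

/-- If the unit combinations of countably many square integrable functions are uniformly tight,
then some positive weight makes their integrals square summable. -/
theorem exists_weight_summable_sq [IsFiniteMeasure m] {S : Type*} [Countable S] {φ : S → T → ℝ}
    (hφ : ∀ s, Measurable (φ s)) (hφ2 : ∀ s, MemLp (φ s) 2 m)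
    (htight : ∀ ε : ℝ≥0∞, ε ≠ 0 → ∃ R : ℝ, ∀ (G : Finset S) (a : S → ℝ), ∑ s ∈ G, a s ^ 2 ≤ 1 →
      m {t | R < ∑ s ∈ G, a s * φ s t} ≤ ε) :
    ∃ w : T → ℝ, Measurable w ∧ (∀ t, 0 ≤ w t) ∧ (∀ t, w t ≤ 1) ∧ (∀ᵐ t ∂m, 0 < w t) ∧
      Summable fun s => (∫ t, φ s t * w t ∂m) ^ 2 := by
  choose R0 hR0 using fun j : ℕ => htight ((1 / 4) ^ j) (by simp)
  set R : ℕ → ℝ := fun j => max 1 (R0 j)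
  have hR1 : ∀ j, 1 ≤ R j := fun j => le_max_left _ _
  obtain ⟨h, hanti, h0, h1, hr, hc⟩ := exists_antitone_weight hR1
  set c : ℕ → ℝ := fun j => (1 / 2 : ℝ) ^ (j + 1) / R j
  have hc0 : ∀ j, 0 < c j := fun j => by
    have := one_pos.trans_le (hR1 j); positivity
  have hinner : ∀ (s : S) (w : Lp ℝ 2 m),
      inner ℝ ((hφ2 s).toLp (φ s)) w = ∫ t, φ s t * w t ∂m := by
    intro s w
    rw [L2.inner_def]
    refine integral_congr_ae ?_
    filter_upwards [(hφ2 s).coeFn_toLp] with t ht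
    simp [ht, mul_comm]
  obtain ⟨w, hw, hsum⟩ := exists_summable_sq_inner (isClosed_weightSet (m := m) c)
    (convex_weightSet c) (B := m.real Set.univ ^ (2 : ℝ≥0∞).toReal⁻¹ * 1)
    (fun w hw => by
      refine Lp.norm_le_of_ae_bound zero_le_one ?_
      filter_upwards [hw.1] with t ht
      rw [Real.norm_of_nonneg ht.1]
      exact ht.2)
    (fun s => (hφ2 s).toLp (φ s)) (D := m.real Set.univ) (by
      intro G a ha
      -- The witness is `h ∘ f`. It falls below `c j` only where `f > R0 j`, a set of measure at
      -- most `4^{-j}`, and `f · h(f) ≤ 1` bounds the pairing by the total mass.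
      set f : T → ℝ := fun t => ∑ s ∈ G, a s * φ s t
      have hf : Measurable f := Finset.measurable_fun_sum _ fun s _ => (hφ s).const_mul _
      have hhf : Measurable fun t => h (f t) := hanti.measurable.comp hf
      have hmem : MemLp (fun t => h (f t)) 2 m := MemLp.of_bound hhf.aestronglyMeasurable 1
        (ae_of_all _ fun t => by rw [Real.norm_of_nonneg (h0 _)]; exact h1 _)
      have hcoe := hmem.coeFn_toLp
      refine ⟨hmem.toLp _, ⟨?_, fun j => ?_⟩, ?_⟩
      · filter_upwards [hcoe] with t ht
        rw [ht]
        exact ⟨h0 _, h1 _⟩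
      · calc ∫⁻ t, ENNReal.ofReal (c j - hmem.toLp _ t) ∂m
            ≤ ∫⁻ t, {t | R0 j < f t}.indicator (fun _ => ENNReal.ofReal (c j)) t ∂m := by
              refine lintegral_mono_ae ?_
              filter_upwards [hcoe] with t ht
              rw [ht, Set.indicator_apply]
              split_ifs with hlt
              · exact ENNReal.ofReal_le_ofReal (by linarith [h0 (f t)])
              · rw [ENNReal.ofReal_eq_zero.2]
                have := hc j (f t) ((not_lt.1 hlt).trans (le_max_right _ _))
                simp only [c]
                linarith
          _ = ENNReal.ofReal (c j) * m {t | R0 j < f t} := by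
              rw [lintegral_indicator_const (measurableSet_lt measurable_const hf)]
          _ ≤ _ := by
              gcongr
              exact hR0 j G a ha
      · rw [sum_inner]
        simp_rw [real_inner_smul_left, hinner, ← integral_const_mul]
        rw [← integral_finsetSum]
        · calc _ ≤ ∫ t, (1 : ℝ) ∂m := by
                refine integral_mono_ae ?_ (integrable_const _) ?_
                · refine integrable_finsetSum _ fun s _ => ?_
                  exact ((hφ2 s).integrable_mul (Lp.memLp _)).const_mul _
                · filter_upwards [hcoe] with t ht
                  simp_rw [ht, ← mul_assoc]
                  rw [← Finset.sum_mul]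
                  exact hr _
            _ = _ := by simp
        · exact fun s _ => ((hφ2 s).integrable_mul (Lp.memLp _)).const_mul _)
  -- Clamping makes the almost everywhere bounds hold at every point.
  refine ⟨fun t => max 0 (min 1 (w t)),
    measurable_const.max (measurable_const.min (Lp.stronglyMeasurable w).measurable),
    fun t => le_max_left _ _, fun t => max_le zero_le_one (min_le_left _ _), ?_, ?_⟩
  · filter_upwards [ae_pos_of_mem_weightSet hc0 hw] with t ht
    exact lt_max_of_lt_right (lt_min one_pos ht)
  · refine hsum.congr fun s => ?_
    rw [hinner]
    refine congrArg (· ^ 2) ?_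
    refine integral_congr_ae ?_
    filter_upwards [hw.1] with t ht
    rw [min_eq_right ht.2, max_eq_right ht.1]

/-- Countably many functions can be made integrable by a common positive density. -/
theorem exists_density_integrable [IsFiniteMeasure m] {S : Type*} [Countable S] {f : S → T → ℝ}
    (hf : ∀ s, Measurable (f s)) :
    ∃ g : T → ℝ, Measurable g ∧ (∀ t, 0 ≤ g t) ∧ (∀ t, g t ≤ 1) ∧ (∀ᵐ t ∂m, 0 < g t) ∧
      ∀ s, Integrable (fun t => f s t * g t) m := by
  obtain ⟨e, he⟩ := Countable.exists_injective_nat S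
  let F : ℕ → T → ℝ := Function.extend e f 0
  have hF : ∀ k, Measurable (F k) := fun k => by
    by_cases hk : ∃ s, e s = k
    · obtain ⟨s, rfl⟩ := hk
      simpa [F, he.extend_apply] using hf s
    · simp only [F, Function.extend_apply' _ _ _ hk]
      exact measurable_zero
  have htend : ∀ k, ∃ R : ℕ, m {t | (R : ℝ) < |F k t|} ≤ (1 / 2) ^ k := by
    intro k
    have h1 : Tendsto (fun R : ℕ => m {t | (R : ℝ) < |F k t|}) atTop
        (𝓝 (m (⋂ R : ℕ, {t | (R : ℝ) < |F k t|}))) :=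
      tendsto_measure_iInter_atTop
        (fun R => (measurableSet_lt measurable_const (hF k).abs).nullMeasurableSet)
        (fun R R' hR t (ht : (R' : ℝ) < _) => lt_of_le_of_lt (Nat.cast_le.2 hR) ht)
        ⟨0, measure_ne_top _ _⟩
    have h2 : (⋂ R : ℕ, {t | (R : ℝ) < |F k t|}) = ∅ := by
      ext t
      simpa using exists_nat_ge |F k t|
    rw [h2, measure_empty] at h1
    exact (h1.eventually_le_const (ENNReal.pow_pos (by simp) k)).exists
  choose R hR using htend
  -- By Borel–Cantelli, `d k * |F k| ≤ 2^{-k}` eventually, so `h = ∑ d k |F k|` is finite almost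
  -- everywhere; the density `1 / (1 + h)` then gives `|F k| / (1 + h) ≤ 1 / d k`.
  let d : ℕ → ℝ := fun k => (1 / 2 : ℝ) ^ k / (R k + 1)
  have hd : ∀ k, 0 < d k := fun k => by positivity
  let h : T → ℝ≥0∞ := fun t => ∑' k, ENNReal.ofReal (d k * |F k t|)
  have hh : Measurable h := Measurable.tsum fun k => ((hF k).abs.const_mul _).ennreal_ofReal
  have hfin : ∀ᵐ t ∂m, h t ≠ ∞ := by
    have hbc : ∀ᵐ t ∂m, ∀ᶠ k in atTop, t ∉ {t | (R k : ℝ) < |F k t|} := by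
      refine ae_eventually_notMem (ne_top_of_le_ne_top ?_ (ENNReal.tsum_le_tsum hR))
      rw [ENNReal.tsum_geometric, one_div, ENNReal.one_sub_inv_two, inv_inv]
      norm_num
    filter_upwards [hbc] with t ht
    refine Summable.tsum_ofReal_ne_top ?_
    refine Summable.of_norm_bounded_eventually_nat summable_geometric_two ?_
    filter_upwards [ht] with k hk
    have hk' : |F k t| ≤ R k := not_lt.1 hk
    rw [Real.norm_of_nonneg (mul_nonneg (hd k).le (abs_nonneg _))]
    have h3 : (0 : ℝ) < R k + 1 := by positivity
    simp only [d]
    rw [div_mul_eq_mul_div, div_le_iff₀ h3]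
    gcongr
    linarith
  have hg1 : ∀ t, (1 + h t)⁻¹ ≤ 1 := fun t => ENNReal.inv_le_one.2 le_self_add
  have hmeas : Measurable fun t => ((1 + h t)⁻¹).toReal := (measurable_const.add hh).inv.ennreal_toReal
  refine ⟨fun t => ((1 + h t)⁻¹).toReal, hmeas, fun t => ENNReal.toReal_nonneg,
    fun t => ?_, ?_, fun s => ?_⟩
  · simpa using ENNReal.toReal_mono ENNReal.one_ne_top (hg1 t)
  · filter_upwards [hfin] with t ht
    exact ENNReal.toReal_pos (by simpa using ht) (ne_top_of_le_ne_top ENNReal.one_ne_top (hg1 t))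
  · refine (integrable_const ((d (e s))⁻¹)).mono' ((hf s).mul hmeas).aestronglyMeasurable
      (ae_of_all _ fun t => ?_)
    have h4 : ENNReal.ofReal (d (e s) * |f s t|) ≤ h t := by
      have := ENNReal.le_tsum (f := fun k => ENNReal.ofReal (d k * |F k t|)) (e s)
      simpa [F, he.extend_apply] using this
    have h5 : ENNReal.ofReal (d (e s) * |f s t|) * (1 + h t)⁻¹ ≤ 1 := by
      rw [← div_eq_mul_inv]
      exact ENNReal.div_le_of_le_mul (by simpa using h4.trans le_add_self)
    have h6 := ENNReal.toReal_mono ENNReal.one_ne_top h5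
    rw [ENNReal.toReal_mul, ENNReal.toReal_ofReal (mul_nonneg (hd _).le (abs_nonneg _)),
      ENNReal.toReal_one] at h6
    rw [norm_mul, Real.norm_eq_abs, Real.norm_of_nonneg ENNReal.toReal_nonneg, ← one_div (d _),
      le_div_iff₀ (hd _)]
    linarith

end Weights

/-! ### Cramér–Wold and uniform absolute continuity -/

section CramerWold

/-- Cramér–Wold: a finite measure on a product of lines is determined by the laws of the finite
linear combinations of the coordinates. -/
theorem measure_ext_of_forall_sum {J : Type*} {μ₁ μ₂ : Measure (J → ℝ)} [IsFiniteMeasure μ₁]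
    [IsFiniteMeasure μ₂]
    (h : ∀ (I : Finset J) (θ : J → ℝ),
      μ₁.map (fun z => ∑ i ∈ I, θ i * z i) = μ₂.map fun z => ∑ i ∈ I, θ i * z i) :
    μ₁ = μ₂ := by
  classical
  refine IsProjectiveLimit.unique (P := fun I : Finset J => μ₁.map I.restrict) (fun I => rfl)
    fun I => ?_
  refine (Measure.ext_of_charFunDual (funext fun L => ?_)).symm
  let θ : J → ℝ := fun j => if hj : j ∈ I then L (Pi.single ⟨j, hj⟩ 1) else 0
  have hL : ∀ z : J → ℝ, L (I.restrict z) = ∑ i ∈ I, θ i * z i := by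
    intro z
    rw [← Finset.sum_coe_sort]
    conv_lhs => rw [← Finset.univ_sum_single (I.restrict z), map_sum]
    refine Finset.sum_congr rfl fun i _ => ?_
    have : Pi.single i (I.restrict z i) = z i • (Pi.single i 1 : I → ℝ) := by
      rw [← Pi.single_smul]; simp
    rw [this, map_smul]
    simp [θ, mul_comm]
  have hmeas : Measurable (I.restrict (π := fun _ => ℝ)) := Finset.measurable_restrict I
  rw [charFunDual_eq_charFun_map_one, charFunDual_eq_charFun_map_one,
    Measure.map_map (by fun_prop) hmeas, Measure.map_map (by fun_prop) hmeas]
  have : ⇑L ∘ I.restrict = fun z : J → ℝ => ∑ i ∈ I, θ i * z i := funext hL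
  rw [this, h]

/-- The uniform form of absolute continuity. -/
theorem exists_pos_forall_measure_lt {α : Type*} [MeasurableSpace α] {μ ν : Measure α}
    [IsFiniteMeasure μ] [IsFiniteMeasure ν] (h : ν ≪ μ) {ε : ℝ≥0∞} (hε : ε ≠ 0) :
    ∃ δ > 0, ∀ s, μ s < δ → ν s < ε := by
  obtain ⟨δ, hδ, H⟩ := exists_pos_setLIntegral_lt_of_measure_lt
    (Measure.lintegral_rnDeriv_lt_top ν μ).ne hε
  refine ⟨δ, hδ, fun s hs => ?_⟩
  have := H s hs
  rwa [Measure.setLIntegral_rnDeriv h] at this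

end CramerWold

/-! ### Independent Gaussian families and tightness of polynomials of the shift -/

section Standard

variable {ι : Type*}

/-- The coordinates are independent standard Gaussian variables, in terms of their linear
combinations. -/
def IsStandard (L : Measure (ι → ℝ)) : Prop :=
  ∀ (F : Finset ι) (θ : ι → ℝ),
    L.map (fun z => ∑ i ∈ F, θ i * z i) = gaussianReal 0 (Real.toNNReal (∑ i ∈ F, θ i ^ 2))

variable {L : Measure (ι → ℝ)}

theorem IsStandard.isProbabilityMeasure (hL : IsStandard L) : IsProbabilityMeasure L := by
  have h := hL ∅ 0
  refine ⟨?_⟩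
  have h1 := congrArg (fun κ : Measure ℝ => κ Set.univ) h
  simpa [Measure.map_apply (show Measurable fun _ : ι → ℝ => (0 : ℝ) from measurable_const)] using h1

theorem IsStandard.memLp_sum (hL : IsStandard L) (F : Finset ι) (θ : ι → ℝ) :
    MemLp (fun z => ∑ i ∈ F, θ i * z i) 2 L := by
  have h : MemLp id 2 (L.map fun z => ∑ i ∈ F, θ i * z i) := by
    rw [hL]; exact memLp_id_gaussianReal 2
  exact (memLp_map_measure_iff (f := fun z : ι → ℝ => ∑ i ∈ F, θ i * z i) (g := id)
    measurable_id.aestronglyMeasurable (Measurable.aemeasurable (by fun_prop))).1 h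

theorem IsStandard.integral_sum_sq (hL : IsStandard L) (F : Finset ι) (θ : ι → ℝ) :
    ∫ z, (∑ i ∈ F, θ i * z i) ^ 2 ∂L = ∑ i ∈ F, θ i ^ 2 := by
  have h1 : ∀ v : NNReal, ∫ x, x ^ 2 ∂(gaussianReal 0 v) = v := fun v => by
    conv_rhs => rw [← variance_fun_id_gaussianReal (μ := 0) (v := v),
      variance_eq_integral measurable_id'.aemeasurable]
    simp
  have h2 := h1 (Real.toNNReal (∑ i ∈ F, θ i ^ 2))
  rw [← hL, Real.coe_toNNReal _ (Finset.sum_nonneg fun _ _ => sq_nonneg _),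
    integral_map (Measurable.aemeasurable (by fun_prop)) (by fun_prop)] at h2
  exact h2

theorem IsStandard.memLp_eval (hL : IsStandard L) (i : ι) : MemLp (fun z : ι → ℝ => z i) 2 L := by
  simpa using hL.memLp_sum {i} 1

theorem IsStandard.integrable_mul (hL : IsStandard L) (i k : ι) :
    Integrable (fun z : ι → ℝ => z i * z k) L :=
  (hL.memLp_eval i).integrable_mul (hL.memLp_eval k)

theorem IsStandard.integral_mul [DecidableEq ι] (hL : IsStandard L) (i k : ι) :
    ∫ z, z i * z k ∂L = if i = k then 1 else 0 := by
  split_ifs with h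
  · subst h
    simpa [pow_two] using hL.integral_sum_sq {i} 1
  · have h1 := hL.integral_sum_sq {i, k} 1
    have h2 := hL.integral_sum_sq {i, k} (fun j => if j = i then 1 else -1)
    simp only [Finset.sum_pair h, Pi.one_apply, if_true, if_neg (Ne.symm h)] at h1 h2
    have e1 : ∀ z : ι → ℝ, z i * z k
        = 4⁻¹ * ((1 * z i + 1 * z k) ^ 2 - (1 * z i + -1 * z k) ^ 2) := fun z => by ring
    have i1 : Integrable (fun z : ι → ℝ => (1 * z i + 1 * z k) ^ 2) L := by
      simpa [Finset.sum_pair h] using (hL.memLp_sum {i, k} 1).integrable_sq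
    have i2 : Integrable (fun z : ι → ℝ => (1 * z i + -1 * z k) ^ 2) L := by
      simpa [Finset.sum_pair h, if_neg (Ne.symm h)] using
        (hL.memLp_sum {i, k} (fun j => if j = i then 1 else -1)).integrable_sq
    simp_rw [e1]
    rw [integral_const_mul, integral_sub i1 i2, h1, h2]
    norm_num

variable {N : ℕ}

theorem IsStandard.map_pi_sum (hL : IsStandard L) (F : Finset ι) (θ : Fin N → ι → ℝ) :
    (Measure.pi fun _ : Fin N => L).map (fun z => ∑ j, ∑ i ∈ F, θ j i * z j i)
      = gaussianReal 0 (Real.toNNReal (∑ j, ∑ i ∈ F, θ j i ^ 2)) := by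
  have := hL.isProbabilityMeasure
  refine Measure.ext_of_charFun (funext fun t => ?_)
  have hind : iIndepFun (fun (j : Fin N) (z : Fin N → ι → ℝ) => ∑ i ∈ F, θ j i * z j i)
      (Measure.pi fun _ : Fin N => L) :=
    iIndepFun_pi (X := fun (j : Fin N) (x : ι → ℝ) => ∑ i ∈ F, θ j i * x i)
      fun j => Measurable.aemeasurable (by fun_prop)
  rw [hind.charFun_map_fun_sum_eq_prod (fun j => Measurable.aemeasurable (by fun_prop)),
    Finset.prod_apply]
  have h1 : ∀ j : Fin N, (Measure.pi fun _ : Fin N => L).map (fun z => ∑ i ∈ F, θ j i * z j i)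
      = gaussianReal 0 (Real.toNNReal (∑ i ∈ F, θ j i ^ 2)) := by
    intro j
    have h2 := hL F (θ j)
    rw [← (measurePreserving_eval (fun _ : Fin N => L) j).map_eq,
      Measure.map_map (by fun_prop) (by fun_prop)] at h2
    exact h2
  simp_rw [h1, charFun_gaussianReal]
  rw [← Complex.exp_sum]
  congr 1
  have h0 : ∀ j, 0 ≤ ∑ i ∈ F, θ j i ^ 2 := fun j => Finset.sum_nonneg fun _ _ => sq_nonneg _
  simp_rw [Real.coe_toNNReal _ (h0 _), Real.coe_toNNReal _ (Finset.sum_nonneg fun j _ => h0 j)]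
  push_cast
  rw [Finset.sum_sub_distrib, Finset.sum_mul, Finset.sum_div]
  simp

/-- A measure on `N`-tuples whose linear combinations have the standard laws is the product. -/
theorem IsStandard.eq_pi (hL : IsStandard L) {κ : Measure (Fin N → ι → ℝ)} [IsFiniteMeasure κ]
    (h : ∀ (F : Finset ι) (θ : Fin N → ι → ℝ),
      κ.map (fun z => ∑ j, ∑ i ∈ F, θ j i * z j i)
        = gaussianReal 0 (Real.toNNReal (∑ j, ∑ i ∈ F, θ j i ^ 2))) :
    κ = Measure.pi fun _ : Fin N => L := by
  classical
  have := hL.isProbabilityMeasure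
  let e : (Fin N × ι → ℝ) → Fin N → ι → ℝ := fun z j i => z (j, i)
  let e' : (Fin N → ι → ℝ) → Fin N × ι → ℝ := fun z p => z p.1 p.2
  have he : Measurable e := by fun_prop
  have he' : Measurable e' := by fun_prop
  suffices H : κ.map e' = (Measure.pi fun _ : Fin N => L).map e' by
    have := congrArg (Measure.map e) H
    rwa [Measure.map_map he he', Measure.map_map he he', show e ∘ e' = id from rfl,
      Measure.map_id, Measure.map_id] at this
  refine measure_ext_of_forall_sum fun I θ => ?_
  rw [Measure.map_map (by fun_prop) he', Measure.map_map (by fun_prop) he']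
  let F : Finset ι := I.image Prod.snd
  let θ' : Fin N → ι → ℝ := fun j i => if (j, i) ∈ I then θ (j, i) else 0
  have hsum : (fun z : Fin N × ι → ℝ => ∑ p ∈ I, θ p * z p) ∘ e'
      = fun z => ∑ j, ∑ i ∈ F, θ' j i * z j i := by
    funext z
    have hI : I ⊆ Finset.univ ×ˢ F := fun p hp =>
      Finset.mem_product.2 ⟨Finset.mem_univ _, Finset.mem_image_of_mem _ hp⟩
    rw [← Finset.sum_product']
    simp only [Function.comp, θ', ite_mul, zero_mul]
    rw [← Finset.sum_filter, Finset.filter_mem_eq_inter, Finset.inter_eq_right.2 hI]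
  rw [hsum, h, hL.map_pi_sum]

theorem IsStandard.map_flip (hL : IsStandard L) {e : Fin N → ℝ} (he : ∀ j, e j ^ 2 = 1) :
    (Measure.pi fun _ : Fin N => L).map (fun z j i => e j * z j i) = Measure.pi fun _ => L := by
  have := hL.isProbabilityMeasure
  refine hL.eq_pi fun F θ => ?_
  rw [Measure.map_map (by fun_prop) (by fun_prop)]
  have := hL.map_pi_sum F fun j i => θ j i * e j
  simp only [mul_pow, he, mul_one, mul_assoc] at this
  exact this

/-- `N` independent standard families, with their mean replaced by a further one. -/
noncomputable def recenter (N : ℕ) (p : (Fin N → ι → ℝ) × (ι → ℝ)) : Fin N → ι → ℝ := fun j i =>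
  p.1 j i - (∑ l, p.1 l i) / N + p.2 i / √N

theorem measurable_recenter : Measurable (recenter (ι := ι) N) := by
  unfold recenter
  fun_prop

/-- The deviations from the mean are independent of the mean, and the mean is distributed as one
family divided by `√N`. In terms of variances: `∑_j (θ_j - θ̄)² + (∑_j θ_j)² / N = ∑_j θ_j²`, with
`θ̄` the average. -/
theorem IsStandard.map_recenter (hL : IsStandard L) (hN : N ≠ 0) :
    ((Measure.pi fun _ : Fin N => L).prod L).map (recenter N) = Measure.pi fun _ => L := by
  have := hL.isProbabilityMeasure
  have hN0 : (N : ℝ) ≠ 0 := Nat.cast_ne_zero.2 hN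
  have hsq : √(N : ℝ) ^ 2 = N := Real.sq_sqrt (Nat.cast_nonneg N)
  have hsq0 : √(N : ℝ) ≠ 0 := by positivity
  refine hL.eq_pi fun F θ => ?_
  rw [Measure.map_map (by fun_prop) measurable_recenter]
  let u : (Fin N → ι → ℝ) → ℝ := fun z => ∑ j, ∑ i ∈ F, (θ j i - (∑ l, θ l i) / N) * z j i
  let v : (ι → ℝ) → ℝ := fun x => ∑ i ∈ F, ((∑ l, θ l i) / √N) * x i
  have hu : Measurable u := by fun_prop
  have hv : Measurable v := by fun_prop
  have hsum : (fun z : Fin N → ι → ℝ => ∑ j, ∑ i ∈ F, θ j i * z j i) ∘ recenter N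
      = (fun p => u p.1) + fun p => v p.2 := by
    funext p
    simp only [Function.comp, recenter, Pi.add_apply, u, v]
    rw [Finset.sum_comm, Finset.sum_comm (s := Finset.univ), ← Finset.sum_add_distrib]
    refine Finset.sum_congr rfl fun i _ => ?_
    simp only [mul_add, mul_sub, sub_mul, Finset.sum_add_distrib, Finset.sum_sub_distrib,
      ← Finset.sum_mul, ← Finset.mul_sum]
    ring
  have hind : IndepFun (fun p : (Fin N → ι → ℝ) × (ι → ℝ) => u p.1) (fun p => v p.2)
      ((Measure.pi fun _ : Fin N => L).prod L) := indepFun_prod hu hv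
  rw [hsum, gaussianReal_add_gaussianReal_of_indepFun hind
    (m₁ := 0) (m₂ := 0)
    (v₁ := Real.toNNReal (∑ j, ∑ i ∈ F, (θ j i - (∑ l, θ l i) / N) ^ 2))
    (v₂ := Real.toNNReal (∑ i ∈ F, ((∑ l, θ l i) / √N) ^ 2)), add_zero, ← Real.toNNReal_add]
  · congr 2
    rw [Finset.sum_comm, Finset.sum_comm (s := Finset.univ), ← Finset.sum_add_distrib]
    refine Finset.sum_congr rfl fun i _ => ?_
    simp only [sub_sq, Finset.sum_add_distrib, Finset.sum_sub_distrib, ← Finset.sum_mul,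
      ← Finset.mul_sum, div_pow, hsq, Finset.sum_const, Finset.card_univ, Fintype.card_fin,
      nsmul_eq_mul]
    field_simp
    ring
  · exact Finset.sum_nonneg fun _ _ => Finset.sum_nonneg fun _ _ => sq_nonneg _
  · exact Finset.sum_nonneg fun _ _ => sq_nonneg _
  · rw [← hL.map_pi_sum, show (fun p : (Fin N → ι → ℝ) × (ι → ℝ) => u p.1) = u ∘ Prod.fst from rfl,
      ← Measure.map_map hu measurable_fst, Measure.map_fst_prod]
    simp [u]
  · rw [← hL, show (fun p : (Fin N → ι → ℝ) × (ι → ℝ) => v p.2) = v ∘ Prod.snd from rfl,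
      ← Measure.map_map hv measurable_snd, Measure.map_snd_prod]
    simp [v]

/-- If the shift by `Λ` is absolutely continuous then so is the simultaneous shift of `N`
independent families by `Λ / √N`. -/
theorem IsStandard.map_shift_absolutelyContinuous (hL : IsStandard L) (hN : N ≠ 0)
    {Λ : Measure (ι → ℝ)} [IsFiniteMeasure Λ] (hΛ : (L.prod Λ).map (fun p => p.1 + p.2) ≪ L) :
    ((Measure.pi fun _ : Fin N => L).prod Λ).map
      (fun p (j : Fin N) (i : ι) => p.1 j i + p.2 i / √N) ≪ Measure.pi fun _ => L := by
  have := hL.isProbabilityMeasure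
  set Q : Measure (Fin N → ι → ℝ) := Measure.pi fun _ : Fin N => L
  have hadd : Measurable fun p : (ι → ℝ) × (ι → ℝ) => p.1 + p.2 := by fun_prop
  -- Replacing the fresh family `x` by `x + y` inside `recenter` adds exactly `y / √N` to each copy,
  -- so the claim is the image of `hΛ` under `recenter`.
  have h1 : Q.prod ((L.prod Λ).map fun p => p.1 + p.2) ≪ Q.prod L :=
    Measure.AbsolutelyContinuous.rfl.prod hΛ
  have h2 := h1.map (measurable_recenter (ι := ι) (N := N))
  rw [hL.map_recenter hN] at h2
  convert! h2 using 1
  have e1 : Q.prod ((L.prod Λ).map fun p => p.1 + p.2)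
      = ((Q.prod L).prod Λ).map fun p => (p.1.1, p.1.2 + p.2) := by
    have := Measure.map_prod_map Q (L.prod Λ) measurable_id hadd
    rw [Measure.map_id] at this
    rw [this, ← (measurePreserving_prodAssoc Q L Λ).map_eq, Measure.map_map (by fun_prop)
      (by fun_prop)]
    rfl
  have e2 : Q.prod Λ = ((Q.prod L).prod Λ).map fun p => (recenter N p.1, p.2) := by
    have := Measure.map_prod_map (Q.prod L) Λ (measurable_recenter (ι := ι) (N := N)) measurable_id
    rw [Measure.map_id, hL.map_recenter hN] at this
    exact this
  have hm : Measurable fun p : ((Fin N → ι → ℝ) × (ι → ℝ)) × (ι → ℝ) => (recenter N p.1, p.2) :=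
    (measurable_recenter.comp measurable_fst).prodMk measurable_snd
  rw [e1, e2, Measure.map_map measurable_recenter (by fun_prop), Measure.map_map (by fun_prop) hm]
  congr 1
  funext p j i
  simp only [Function.comp, recenter, Pi.add_apply]
  ring

/-- With one independent copy per factor, the monomials `∏ j, z j (s j)` are orthonormal; repeated
indices produce no diagonal terms. -/
theorem IsStandard.integral_multilinear_sq (hL : IsStandard L) (G : Finset (Fin N → ι))
    (a : (Fin N → ι) → ℝ) :
    Integrable (fun z : Fin N → ι → ℝ => (∑ s ∈ G, a s * ∏ j, z j (s j)) ^ 2)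
      (Measure.pi fun _ => L) ∧
    ∫ z : Fin N → ι → ℝ, (∑ s ∈ G, a s * ∏ j, z j (s j)) ^ 2 ∂(Measure.pi fun _ => L)
      = ∑ s ∈ G, a s ^ 2 := by
  classical
  have := hL.isProbabilityMeasure
  have hexp : ∀ z : Fin N → ι → ℝ, (∑ s ∈ G, a s * ∏ j, z j (s j)) ^ 2
      = ∑ s ∈ G, ∑ s' ∈ G, a s * a s' * ∏ j, (z j (s j) * z j (s' j)) := by
    intro z
    rw [pow_two, Finset.sum_mul_sum]
    refine Finset.sum_congr rfl fun s _ => Finset.sum_congr rfl fun s' _ => ?_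
    rw [Finset.prod_mul_distrib]
    ring
  have hint : ∀ s s' : Fin N → ι, Integrable
      (fun z : Fin N → ι → ℝ => a s * a s' * ∏ j, (z j (s j) * z j (s' j)))
      (Measure.pi fun _ => L) := fun s s' =>
    (Integrable.fintype_prod (f := fun (j : Fin N) (x : ι → ℝ) => x (s j) * x (s' j))
      fun j => hL.integrable_mul _ _).const_mul _
  simp_rw [hexp]
  refine ⟨integrable_finsetSum _ fun s _ => integrable_finsetSum _ fun s' _ => hint s s', ?_⟩
  rw [integral_finsetSum _ fun s _ => integrable_finsetSum _ fun s' _ => hint s s']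
  refine Finset.sum_congr rfl fun s hs => ?_
  rw [integral_finsetSum _ fun s' _ => hint s s']
  have hval : ∀ s', ∫ z : Fin N → ι → ℝ, a s * a s' * ∏ j, (z j (s j) * z j (s' j))
      ∂(Measure.pi fun _ => L) = if s = s' then a s ^ 2 else 0 := by
    intro s'
    rw [integral_const_mul, integral_fintype_prod_eq_prod
      (fun (j : Fin N) (x : ι → ℝ) => x (s j) * x (s' j))]
    simp_rw [hL.integral_mul]
    split_ifs with h
    · subst h; simp [pow_two]
    · obtain ⟨j, hj⟩ := Function.ne_iff.1 h
      rw [Finset.prod_eq_zero (Finset.mem_univ j) (if_neg hj), mul_zero]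
  simp_rw [hval]
  rw [Finset.sum_ite_eq, if_pos hs]

/-- Chebyshev's inequality, with a bound uniform in `G` and `a`. -/
theorem IsStandard.measure_lt_multilinear (hL : IsStandard L) (G : Finset (Fin N → ι))
    {a : (Fin N → ι) → ℝ} (ha : ∑ s ∈ G, a s ^ 2 ≤ 1) {R : ℝ} (hR : 0 < R) :
    (Measure.pi fun _ => L) {z : Fin N → ι → ℝ | R < |∑ s ∈ G, a s * ∏ j, z j (s j)|}
      ≤ ENNReal.ofReal (1 / R ^ 2) := by
  have := hL.isProbabilityMeasure
  obtain ⟨h1, h2⟩ := hL.integral_multilinear_sq G a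
  have h3 := mul_meas_ge_le_integral_of_nonneg (ae_of_all _ fun z => sq_nonneg _) h1 (R ^ 2)
  rw [h2] at h3
  rw [← ENNReal.ofReal_toReal (measure_ne_top (Measure.pi fun _ => L) _)]
  refine ENNReal.ofReal_le_ofReal ?_
  rw [le_div_iff₀ (by positivity), mul_comm]
  refine le_trans ?_ (h3.trans ha)
  refine mul_le_mul_of_nonneg_left (ENNReal.toReal_mono (measure_ne_top _ _)
    (measure_mono fun z (hz : R < _) => ?_)) (sq_nonneg _)
  change R ^ 2 ≤ _
  rw [← sq_abs (∑ s ∈ G, _)]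
  exact pow_le_pow_left₀ hR.le hz.le 2

/-- The homogeneous polynomials of degree `N` with coefficients in the unit ball are uniformly
tight under an admissible law of random shifts. -/
theorem IsStandard.tight_of_shift (hL : IsStandard L) (hN : N ≠ 0)
    {Λ : Measure (ι → ℝ)} [IsFiniteMeasure Λ] (hΛ : (L.prod Λ).map (fun p => p.1 + p.2) ≪ L)
    {ε : ℝ≥0∞} (hε : ε ≠ 0) :
    ∃ R : ℝ, ∀ (G : Finset (Fin N → ι)) (a : (Fin N → ι) → ℝ), ∑ s ∈ G, a s ^ 2 ≤ 1 →
      Λ {y | R < |∑ s ∈ G, a s * ∏ j, y (s j)|} ≤ ε := by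
  have := hL.isProbabilityMeasure
  set Q : Measure (Fin N → ι → ℝ) := Measure.pi fun _ : Fin N => L with hQ
  let S : (Fin N → ι → ℝ) × (ι → ℝ) → Fin N → ι → ℝ := fun p j i => p.1 j i + p.2 i / √N
  have hS : Measurable S := by fun_prop
  have hac : (Q.prod Λ).map S ≪ Q := hL.map_shift_absolutelyContinuous hN hΛ
  -- The factor `2 ^ N` allows for a union bound over all sign patterns.
  obtain ⟨δ, hδ, H⟩ := exists_pos_forall_measure_lt hac
    (ENNReal.div_ne_zero.2 ⟨hε, ENNReal.natCast_ne_top (2 ^ N)⟩)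
  obtain ⟨R, hR0, hR⟩ : ∃ R : ℝ, 0 < R ∧ ENNReal.ofReal (1 / R ^ 2) < δ := by
    have h1 : Tendsto (fun R : ℝ => ENNReal.ofReal (1 / R ^ 2)) atTop (𝓝 0) := by
      rw [← ENNReal.ofReal_zero]
      refine (ENNReal.continuous_ofReal.tendsto 0).comp ?_
      simp_rw [one_div]
      exact tendsto_inv_atTop_zero.comp (tendsto_pow_atTop two_ne_zero)
    exact ((eventually_gt_atTop 0).and (h1.eventually_lt_const hδ)).exists
  have hc : (0 : ℝ) < √N := by positivity
  let sg : Bool → ℝ := fun b => if b then 1 else -1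
  refine ⟨R * √N ^ N, fun G a ha => ?_⟩
  let f : (Fin N → ι → ℝ) → ℝ := fun z => ∑ s ∈ G, a s * ∏ j, z j (s j)
  have hf : Measurable f := by fun_prop
  let flip : (Fin N → Bool) → (Fin N → ι → ℝ) → Fin N → ι → ℝ := fun e z j i => sg (e j) * z j i
  have hflip : ∀ e, Measurable (flip e) := fun e => by fun_prop
  have hflipQ : ∀ e, Q.map (flip e) = Q := fun e => hL.map_flip fun j => by
    simp only [sg]; split_ifs <;> norm_num
  let B : (Fin N → Bool) → Set ((Fin N → ι → ℝ) × (ι → ℝ)) := fun e =>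
    {p | R < |f (S (flip e p.1, p.2))|}
  have hB : ∀ e, (Q.prod Λ) (B e) ≤ ε / ((2 ^ N : ℕ) : ℝ≥0∞) := by
    intro e
    have hA : MeasurableSet {z : Fin N → ι → ℝ | R < |f z|} :=
      measurableSet_lt measurable_const hf.abs
    have h1 := H {z | R < |f z|} ((hL.measure_lt_multilinear G ha hR0).trans_lt hR)
    have h2 : (Q.prod Λ).map (fun p => (flip e p.1, p.2)) = Q.prod Λ := by
      have := Measure.map_prod_map Q Λ (hflip e) measurable_id
      rw [Measure.map_id, hflipQ] at this
      exact this.symm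
    rw [← h2, Measure.map_map hS (by fun_prop), Measure.map_apply (by fun_prop) hA] at h1
    exact h1.le
  -- Summing `∏_j (±z_j + y / √N)` over all signs leaves `2^N ∏_j y / √N`. So if the polynomial in
  -- `y` exceeds `R √N^N`, some sign pattern makes the shifted decoupled polynomial exceed `R`.
  have hcover : Set.univ ×ˢ {y : ι → ℝ | R * √N ^ N < |∑ s ∈ G, a s * ∏ j, y (s j)|}
      ⊆ ⋃ e, B e := by
    rintro ⟨z, y⟩ ⟨-, hy⟩
    by_contra hcon
    simp only [Set.mem_iUnion, not_exists] at hcon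
    have hle : ∀ e, |f (S (flip e z, y))| ≤ R := fun e => not_lt.1 (hcon e)
    have hsum : ∑ e : Fin N → Bool, f (S (flip e z, y))
        = 2 ^ N * (∑ s ∈ G, a s * ∏ j, y (s j)) / √N ^ N := by
      simp only [f]
      rw [Finset.sum_comm, Finset.mul_sum, Finset.sum_div]
      refine Finset.sum_congr rfl fun s _ => ?_
      rw [← Finset.mul_sum]
      have := Finset.prod_univ_sum (fun _ : Fin N => (Finset.univ : Finset Bool))
        (fun j b => sg b * z j (s j) + y (s j) / √N)
      rw [Fintype.piFinset_univ] at this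
      simp only [S, flip]
      rw [← this]
      have h3 : ∀ j, ∑ b : Bool, (sg b * z j (s j) + y (s j) / √N) = (2 / √N) * y (s j) := by
        intro j
        simp [sg]
        ring
      simp_rw [h3]
      rw [Finset.prod_mul_distrib, Finset.prod_const, Finset.card_univ, Fintype.card_fin, div_pow]
      ring
    have h4 : |∑ e : Fin N → Bool, f (S (flip e z, y))| ≤ 2 ^ N * R := by
      refine (Finset.abs_sum_le_sum_abs _ _).trans ((Finset.sum_le_sum fun e _ => hle e).trans ?_)
      simp
    rw [hsum, abs_div, abs_mul, abs_of_pos (by positivity : (0 : ℝ) < 2 ^ N),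
      abs_of_pos (by positivity : (0 : ℝ) < √N ^ N), mul_div_assoc] at h4
    have h5 := le_of_mul_le_mul_left h4 (by positivity)
    rw [div_le_iff₀ (by positivity)] at h5
    exact absurd hy (not_lt.2 h5)
  calc Λ {y | R * √N ^ N < |∑ s ∈ G, a s * ∏ j, y (s j)|}
      = (Q.prod Λ) (Set.univ ×ˢ {y | R * √N ^ N < |∑ s ∈ G, a s * ∏ j, y (s j)|}) := by
        rw [Measure.prod_prod, measure_univ, one_mul]
    _ ≤ (Q.prod Λ) (⋃ e, B e) := measure_mono hcover
    _ ≤ ∑ e, (Q.prod Λ) (B e) := measure_iUnion_fintype_le _ _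
    _ ≤ ∑ e : Fin N → Bool, ε / ((2 ^ N : ℕ) : ℝ≥0∞) := Finset.sum_le_sum fun e _ => hB e
    _ = ε := by
        rw [Finset.sum_const, Finset.card_univ, Fintype.card_fun, Fintype.card_bool,
          Fintype.card_fin, nsmul_eq_mul]
        exact ENNReal.mul_div_cancel (by simp) (ENNReal.natCast_ne_top _)

end Standard

/-! ### Linearity of the pairing, almost everywhere -/

section Pairing

variable {H : Type*} [NormedAddCommGroup H] [InnerProductSpace ℝ H]
variable {S : Type*} [MeasurableSpace S] {μ : Measure S}

theorem GenFun.pair_add (Y : GenFun H μ) (ξ η : H) :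
    Y.pair (ξ + η) =ᵐ[μ] fun t => Y.pair ξ t + Y.pair η t := by
  have h : Y.pair (ξ + η) = (Y.op ξ + Y.op η : S →ₘ[μ] ℝ) := by
    funext t; rw [← map_add]; rfl
  rw [h]
  exact AEEqFun.coeFn_add _ _

theorem GenFun.pair_smul (Y : GenFun H μ) (c : ℝ) (ξ : H) :
    Y.pair (c • ξ) =ᵐ[μ] fun t => c * Y.pair ξ t := by
  have h : Y.pair (c • ξ) = (c • Y.op ξ : S →ₘ[μ] ℝ) := by
    funext t; rw [← map_smul]; rfl
  rw [h]
  exact AEEqFun.coeFn_smul _ _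

theorem GenFun.pair_zero (Y : GenFun H μ) : Y.pair 0 =ᵐ[μ] fun _ => 0 := by
  filter_upwards [Y.pair_smul 0 0] with t ht
  rw [← zero_smul ℝ (0 : H), ht, zero_mul]

theorem GenFun.pair_sum (Y : GenFun H μ) {ι : Type*} (F : Finset ι) (θ : ι → ℝ) (v : ι → H) :
    Y.pair (∑ i ∈ F, θ i • v i) =ᵐ[μ] fun t => ∑ i ∈ F, θ i * Y.pair (v i) t := by
  classical
  induction F using Finset.induction_on with
  | empty => simpa using Y.pair_zero
  | insert i F hi ih =>
    rw [Finset.sum_insert hi]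
    filter_upwards [Y.pair_add (θ i • v i) (∑ i ∈ F, θ i • v i), Y.pair_smul (θ i) (v i), ih]
      with t h1 h2 h3
    rw [h1, h2, h3, Finset.sum_insert hi]

end Pairing

/-! ### Uniqueness of Laplace transforms -/

section Laplace

/-- Finite measures are determined by their Laplace transforms. -/
theorem map_eq_map_of_lintegral_exp {Ω₁ Ω₂ : Type*} [MeasurableSpace Ω₁] [MeasurableSpace Ω₂]
    {m₁ : Measure Ω₁} {m₂ : Measure Ω₂} [IsFiniteMeasure m₁] [IsFiniteMeasure m₂]
    {Z₁ : Ω₁ → ℝ} {Z₂ : Ω₂ → ℝ} (h₁ : Measurable Z₁) (h₂ : Measurable Z₂)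
    (h : ∀ s : ℝ, ∫⁻ ω, ENNReal.ofReal (Real.exp (s * Z₁ ω)) ∂m₁
      = ∫⁻ ω, ENNReal.ofReal (Real.exp (s * Z₂ ω)) ∂m₂)
    (hfin : ∀ s : ℝ, ∫⁻ ω, ENNReal.ofReal (Real.exp (s * Z₁ ω)) ∂m₁ ≠ ∞) :
    m₁.map Z₁ = m₂.map Z₂ := by
  have hm₁ : ∀ s : ℝ, Measurable fun ω => Real.exp (s * Z₁ ω) := fun s => by fun_prop
  have hm₂ : ∀ s : ℝ, Measurable fun ω => Real.exp (s * Z₂ ω) := fun s => by fun_prop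
  have hmgf : mgf Z₁ m₁ = mgf Z₂ m₂ := by
    funext s
    rw [mgf, mgf, integral_eq_lintegral_of_nonneg_ae (ae_of_all _ fun _ => (Real.exp_pos _).le)
      (hm₁ s).aestronglyMeasurable, integral_eq_lintegral_of_nonneg_ae
      (ae_of_all _ fun _ => (Real.exp_pos _).le) (hm₂ s).aestronglyMeasurable, h]
  have hzero : m₁ = 0 ↔ m₂ = 0 := by
    rw [← Measure.measure_univ_eq_zero, ← Measure.measure_univ_eq_zero]
    have := h 0
    simp only [zero_mul, Real.exp_zero, ENNReal.ofReal_one, lintegral_one] at this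
    rw [this]
  have huniv : integrableExpSet Z₁ m₁ = Set.univ := Set.eq_univ_of_forall fun s =>
    ⟨(hm₁ s).aestronglyMeasurable, by
      rw [hasFiniteIntegral_iff_ofReal (ae_of_all _ fun _ => (Real.exp_pos _).le)]
      exact (hfin s).lt_top⟩
  refine Measure.ext_of_complexMGF_eq h₁.aemeasurable h₂.aemeasurable (funext fun z => ?_)
  exact eqOn_complexMGF_of_mgf' hmgf hzero (by simp [huniv])

end Laplace

/-! ### Standard Gaussian fields and Cameron–Martin -/

section Gaussian

variable {H : Type*} [NormedAddCommGroup H] [InnerProductSpace ℝ H]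
variable {Ω : Type*} [MeasurableSpace Ω] {P : Measure Ω}

theorem lintegral_exp_pair {X : GenFun H P} (hX : IsStandardGaussian X) (η : H) :
    ∫⁻ ω, ENNReal.ofReal (Real.exp (X.pair η ω)) ∂P = ENNReal.ofReal (Real.exp (‖η‖ ^ 2 / 2)) := by
  have hm : Measurable fun x : ℝ => ENNReal.ofReal (Real.exp x) := by fun_prop
  have h1 : ∫⁻ x, ENNReal.ofReal (Real.exp x) ∂(gaussianReal 0 (‖η‖₊ ^ 2))
      = ENNReal.ofReal (Real.exp (‖η‖ ^ 2 / 2)) := by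
    have hi := integrable_exp_mul_gaussianReal (μ := 0) (v := ‖η‖₊ ^ 2) 1
    have hg := congrFun (mgf_fun_id_gaussianReal (μ := 0) (v := ‖η‖₊ ^ 2)) 1
    simp only [one_mul] at hi
    rw [← ofReal_integral_eq_lintegral_ofReal hi (ae_of_all _ fun _ => (Real.exp_pos _).le)]
    simp only [mgf, one_mul] at hg
    rw [hg]
    simp
  rw [← h1, ← hX η, lintegral_map hm (X.measurable_pair η)]

theorem isStandard_map_pair [IsProbabilityMeasure P] {X : GenFun H P} (hX : IsStandardGaussian X)
    {ι : Type*} {b : ι → H} (hb : Orthonormal ℝ b) :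
    IsStandard (P.map fun ω i => X.pair (b i) ω) := by
  intro F θ
  have hm : Measurable fun ω i => X.pair (b i) ω := measurable_pi_iff.2 fun i => X.measurable_pair _
  rw [Measure.map_map (by fun_prop) hm,
    show gaussianReal 0 (Real.toNNReal (∑ i ∈ F, θ i ^ 2))
      = gaussianReal 0 (‖∑ i ∈ F, θ i • b i‖₊ ^ 2) from ?_, ← hX]
  · exact Measure.map_congr (X.pair_sum F θ b).symm
  · congr 1
    rw [← NNReal.coe_inj, NNReal.coe_pow, coe_nnnorm, ← real_inner_self_eq_norm_sq, hb.inner_sum,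
      Real.coe_toNNReal _ (Finset.sum_nonneg fun _ _ => sq_nonneg _)]
    simp [pow_two]

/-- The Cameron–Martin formula. -/
theorem lintegral_shift_val [IsProbabilityMeasure P] {X : GenFun H P} (hX : IsStandardGaussian X)
    (ξ : H) {f : (H → ℝ) → ℝ≥0∞} (hf : Measurable f) :
    ∫⁻ ω, f (X.val ω + fun η => inner ℝ ξ η) ∂P
      = ∫⁻ ω, ENNReal.ofReal (Real.exp (X.pair ξ ω - ‖ξ‖ ^ 2 / 2)) * f (X.val ω) ∂P := by
  set D : Ω → ℝ≥0∞ := fun ω => ENNReal.ofReal (Real.exp (X.pair ξ ω - ‖ξ‖ ^ 2 / 2)) with hDdef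
  have hpm := X.measurable_pair
  have hD : Measurable D := by have := hpm ξ; fun_prop
  have hlap : ∀ η : H, ∫⁻ ω, ENNReal.ofReal (Real.exp (X.pair η ω)) ∂(P.withDensity D)
      = ENNReal.ofReal (Real.exp (‖η‖ ^ 2 / 2 + inner ℝ ξ η)) := by
    intro η
    rw [lintegral_withDensity_eq_lintegral_mul _ hD (by have := hpm η; fun_prop)]
    calc _ = ∫⁻ ω, ENNReal.ofReal (Real.exp (- ‖ξ‖ ^ 2 / 2))
              * ENNReal.ofReal (Real.exp (X.pair (ξ + η) ω)) ∂P := by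
          refine lintegral_congr_ae ?_
          filter_upwards [X.pair_add ξ η] with ω hω
          rw [hω, Pi.mul_apply, hDdef, ← ENNReal.ofReal_mul (Real.exp_pos _).le,
            ← ENNReal.ofReal_mul (Real.exp_pos _).le, ← Real.exp_add, ← Real.exp_add]
          ring_nf
      _ = _ := by
          rw [lintegral_const_mul _ (by have := hpm (ξ + η); fun_prop), lintegral_exp_pair hX,
            ← ENNReal.ofReal_mul (Real.exp_pos _).le, ← Real.exp_add, norm_add_sq_real]
          ring_nf
  have hfin : IsFiniteMeasure (P.withDensity D) := by
    refine isFiniteMeasure_withDensity ?_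
    have h1 := hlap 0
    have h2 : ∫⁻ ω, ENNReal.ofReal (Real.exp (X.pair 0 ω)) ∂(P.withDensity D)
        = ∫⁻ ω, D ω ∂P := by
      rw [← setLIntegral_univ D, ← withDensity_apply _ MeasurableSet.univ, ← lintegral_one]
      refine lintegral_congr_ae ?_
      filter_upwards [(withDensity_absolutelyContinuous P D).ae_le X.pair_zero] with ω hω
      simp [hω]
    rw [← h2, h1]
    exact ENNReal.ofReal_ne_top
  have hval := X.measurable_val
  have hsh : Measurable fun ω => X.val ω + fun η => inner ℝ ξ η := hval.add_const _
  have key : P.map (fun ω => X.val ω + fun η => inner ℝ ξ η) = (P.withDensity D).map X.val := by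
    refine measure_ext_of_forall_sum fun I θ => ?_
    -- The coordinates are indexed by `H` itself, so a combination of them is almost surely one
    -- pairing, with `η`; comparing one-dimensional Laplace transforms is enough.
    set η : H := ∑ i ∈ I, θ i • i with hη
    rw [Measure.map_map (by fun_prop) hsh, Measure.map_map (by fun_prop) hval]
    have e1 : (fun z : H → ℝ => ∑ i ∈ I, θ i * z i) ∘ (fun ω => X.val ω + fun η => inner ℝ ξ η)
        =ᵐ[P] fun ω => X.pair η ω + inner ℝ ξ η := by
      filter_upwards [X.pair_sum I θ fun i => i] with ω hω
      rw [hω, hη, inner_sum]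
      simp [GenFun.val, mul_add, Finset.sum_add_distrib, inner_smul_right]
    have e2 : (fun z : H → ℝ => ∑ i ∈ I, θ i * z i) ∘ X.val =ᵐ[P.withDensity D] X.pair η := by
      filter_upwards [(withDensity_absolutelyContinuous P D).ae_le (X.pair_sum I θ fun i => i)]
        with ω hω
      exact hω.symm
    rw [Measure.map_congr e1, Measure.map_congr e2]
    have hl : ∀ s : ℝ, ∫⁻ ω, ENNReal.ofReal (Real.exp (s * (X.pair η ω + inner ℝ ξ η))) ∂P
        = ENNReal.ofReal (Real.exp (‖s • η‖ ^ 2 / 2 + inner ℝ ξ (s • η))) := by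
      intro s
      rw [Real.exp_add, ENNReal.ofReal_mul (Real.exp_pos _).le, ← lintegral_exp_pair hX,
        ← lintegral_mul_const _ (by have := hpm (s • η); fun_prop)]
      refine lintegral_congr_ae ?_
      filter_upwards [X.pair_smul s η] with ω hω
      rw [hω, ← ENNReal.ofReal_mul (Real.exp_pos _).le, ← Real.exp_add, inner_smul_right, mul_add]
    refine map_eq_map_of_lintegral_exp ((hpm η).add_const _) (hpm η) (fun s => ?_) fun s => ?_
    · rw [hl, ← hlap]
      refine lintegral_congr_ae ?_
      filter_upwards [(withDensity_absolutelyContinuous P D).ae_le (X.pair_smul s η)] with ω hω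
      rw [hω]
    · rw [hl]; exact ENNReal.ofReal_ne_top
  rw [← lintegral_map hf hsh, key, lintegral_map hf hval,
    lintegral_withDensity_eq_lintegral_mul _ hD (g := fun ω => f (X.val ω)) (hf.comp hval)]
  rfl

end Gaussian

/-! ### From a chaos to a randomized shift -/

section Chaos

variable {H : Type*} [NormedAddCommGroup H] [InnerProductSpace ℝ H]
variable {Ω : Type*} [MeasurableSpace Ω] {P : Measure Ω}
variable {T : Type*} [MeasurableSpace T] {μ : Measure T}
variable {X : GenFun H P} {Y : GenFun H μ} {M : Kernel (H → ℝ) T}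

theorem lintegral_expectedMeasure {h : T → ℝ≥0∞} (hh : Measurable h) :
    ∫⁻ t, h t ∂(expectedMeasure X M) = ∫⁻ ω, ∫⁻ t, h t ∂(M (X.val ω)) ∂P :=
  Measure.lintegral_bind (M.measurable.comp X.measurable_val).aemeasurable hh.aemeasurable

/-- The exponential moments of the field under a chaos density are those of the shifted field. -/
theorem IsChaos.lintegral_exp [IsProbabilityMeasure P] (hM : IsChaos X Y M)
    (hX : IsStandardGaussian X)
    {h : T → ℝ≥0∞} (hh : Measurable h) (ξ : H) :
    ∫⁻ ω, ENNReal.ofReal (Real.exp (X.pair ξ ω)) * ∫⁻ t, h t ∂(M (X.val ω)) ∂P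
      = ENNReal.ofReal (Real.exp (‖ξ‖ ^ 2 / 2)) *
        ∫⁻ t, ENNReal.ofReal (Real.exp (Y.pair ξ t)) * h t ∂(expectedMeasure X M) := by
  have hY : Measurable fun t => ENNReal.ofReal (Real.exp (Y.pair ξ t)) := by
    have := Y.measurable_pair ξ; fun_prop
  have hF : Measurable fun x : H → ℝ => ∫⁻ t, h t ∂(M x) := hh.lintegral_kernel
  rw [lintegral_expectedMeasure
    (h := fun t => ENNReal.ofReal (Real.exp (Y.pair ξ t)) * h t) (hY.mul hh)]
  have h1 : ∫⁻ ω, ∫⁻ t, ENNReal.ofReal (Real.exp (Y.pair ξ t)) * h t ∂(M (X.val ω)) ∂P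
      = ∫⁻ ω, ∫⁻ t, h t ∂(M (X.val ω + fun η => inner ℝ ξ η)) ∂P := by
    refine lintegral_congr_ae ?_
    filter_upwards [hM.shift ξ] with ω hω
    rw [hω, lintegral_withDensity_eq_lintegral_mul _ hY hh]
    rfl
  rw [h1, lintegral_shift_val hX ξ hF, ← lintegral_const_mul _ (by
    have := X.measurable_pair ξ
    have := hF.comp X.measurable_val
    fun_prop)]
  refine lintegral_congr fun ω => ?_
  rw [← mul_assoc, ← ENNReal.ofReal_mul (Real.exp_pos _).le, ← Real.exp_add]
  ring_nf

/-- Both sides have Laplace transform `exp(s²‖ξ‖²/2) ∫ exp(s⟨Y,ξ⟩) h d(E M)`. It may be infinite, so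
`h` is first restricted to `|⟨Y,ξ⟩| ≤ R` and then `R → ∞`. -/
theorem IsChaos.map_pair_eq [IsProbabilityMeasure P] (hM : IsChaos X Y M)
    (hX : IsStandardGaussian X)
    {h : T → ℝ≥0∞} (hh : Measurable h) (hfin : ∫⁻ t, h t ∂(expectedMeasure X M) ≠ ∞) (ξ : H) :
    (P.withDensity fun ω => ∫⁻ t, h t ∂(M (X.val ω))).map (X.pair ξ)
      = (P.prod ((expectedMeasure X M).withDensity h)).map
          fun p => X.pair ξ p.1 + Y.pair ξ p.2 := by
  have hXm := X.measurable_pair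
  have hYm := Y.measurable_pair
  set m := expectedMeasure X M with hm
  let B : ℕ → Set T := fun R => {t | |Y.pair ξ t| ≤ R}
  have hB : ∀ R, MeasurableSet (B R) := fun R => measurableSet_le (hYm ξ).abs measurable_const
  have hBmono : Monotone B := fun R R' hR t (ht : |Y.pair ξ t| ≤ R) =>
    (ht.trans (Nat.cast_le.2 hR) : |Y.pair ξ t| ≤ R')
  have hBU : ⋃ R, B R = Set.univ := Set.eq_univ_of_forall fun t =>
    Set.mem_iUnion.2 (exists_nat_ge |Y.pair ξ t|)
  have hF : ∀ {h : T → ℝ≥0∞}, Measurable h → Measurable fun ω => ∫⁻ t, h t ∂(M (X.val ω)) :=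
    fun hh => hh.lintegral_kernel.comp X.measurable_val
  have hfinite : ∀ {h : T → ℝ≥0∞}, Measurable h → ∫⁻ t, h t ∂m ≠ ∞ →
      IsFiniteMeasure (P.withDensity fun ω => ∫⁻ t, h t ∂(M (X.val ω))) ∧
      IsFiniteMeasure (m.withDensity h) := fun hh hfin =>
    ⟨isFiniteMeasure_withDensity (by rwa [← lintegral_expectedMeasure hh]),
      isFiniteMeasure_withDensity hfin⟩
  have htrunc : ∀ R, (P.withDensity fun ω => ∫⁻ t, (B R).indicator h t ∂(M (X.val ω))).map (X.pair ξ)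
      = (P.prod (m.withDensity ((B R).indicator h))).map
          fun p => X.pair ξ p.1 + Y.pair ξ p.2 := by
    intro R
    have hhR : Measurable ((B R).indicator h) := hh.indicator (hB R)
    have hfinR : ∫⁻ t, (B R).indicator h t ∂m ≠ ∞ :=
      ne_top_of_le_ne_top hfin (lintegral_mono (Set.indicator_le_self _ _))
    obtain ⟨_, _⟩ := hfinite hhR hfinR
    have hL : ∀ s : ℝ, ∫⁻ ω, ENNReal.ofReal (Real.exp (s * X.pair ξ ω))
          ∂(P.withDensity fun ω => ∫⁻ t, (B R).indicator h t ∂(M (X.val ω)))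
        = ENNReal.ofReal (Real.exp (‖s • ξ‖ ^ 2 / 2)) *
          ∫⁻ t, ENNReal.ofReal (Real.exp (s * Y.pair ξ t)) * (B R).indicator h t ∂m := by
      intro s
      rw [lintegral_withDensity_eq_lintegral_mul _ (hF hhR) (by have := hXm ξ; fun_prop)]
      have e1 : ∫⁻ t, ENNReal.ofReal (Real.exp (s * Y.pair ξ t)) * (B R).indicator h t ∂m
          = ∫⁻ t, ENNReal.ofReal (Real.exp (Y.pair (s • ξ) t)) * (B R).indicator h t ∂m := by
        refine lintegral_congr_ae ?_
        filter_upwards [hM.expected_ac.ae_le (Y.pair_smul s ξ)] with t ht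
        rw [ht]
      rw [e1, ← hM.lintegral_exp hX hhR]
      refine lintegral_congr_ae ?_
      filter_upwards [X.pair_smul s ξ] with ω hω
      rw [Pi.mul_apply, hω, mul_comm]
    refine map_eq_map_of_lintegral_exp (hXm ξ) (by have := hXm ξ; have := hYm ξ; fun_prop)
      (fun s => ?_) fun s => ?_
    · rw [hL, ← lintegral_exp_pair hX]
      have e2 : ∀ p : Ω × T, ENNReal.ofReal (Real.exp (s * (X.pair ξ p.1 + Y.pair ξ p.2)))
          = ENNReal.ofReal (Real.exp (s * X.pair ξ p.1))
            * ENNReal.ofReal (Real.exp (s * Y.pair ξ p.2)) := fun p => by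
        rw [← ENNReal.ofReal_mul (Real.exp_pos _).le, ← Real.exp_add, mul_add]
      simp_rw [e2]
      rw [lintegral_prod_mul (f := fun ω => ENNReal.ofReal (Real.exp (s * X.pair ξ ω)))
        (g := fun t => ENNReal.ofReal (Real.exp (s * Y.pair ξ t)))
        (by have := hXm ξ; fun_prop) (by have := hYm ξ; fun_prop),
        lintegral_withDensity_eq_lintegral_mul _ hhR (by have := hYm ξ; fun_prop)]
      congr 1
      · refine lintegral_congr_ae ?_
        filter_upwards [X.pair_smul s ξ] with ω hω
        rw [hω]
      · refine lintegral_congr fun t => ?_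
        rw [Pi.mul_apply, mul_comm]
    · rw [hL]
      refine ENNReal.mul_ne_top ENNReal.ofReal_ne_top ?_
      refine ne_top_of_le_ne_top (ENNReal.mul_ne_top
        (ENNReal.ofReal_ne_top (r := Real.exp (|s| * R))) hfin) ?_
      rw [← lintegral_const_mul _ hh]
      refine lintegral_mono fun t => ?_
      by_cases ht : t ∈ B R
      · rw [Set.indicator_of_mem ht]
        refine mul_le_mul_left (ENNReal.ofReal_le_ofReal (Real.exp_le_exp.2 ?_)) _
        calc s * Y.pair ξ t ≤ |s| * |Y.pair ξ t| := by rw [← abs_mul]; exact le_abs_self _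
          _ ≤ |s| * R := mul_le_mul_of_nonneg_left ht (abs_nonneg _)
      · simp [Set.indicator_of_notMem ht]
  obtain ⟨_, _⟩ := hfinite hh hfin
  have hadd : Measurable fun p : Ω × T => X.pair ξ p.1 + Y.pair ξ p.2 :=
    ((hXm ξ).comp measurable_fst).add ((hYm ξ).comp measurable_snd)
  have hsup : ∀ κ : Measure T, ∫⁻ t, h t ∂κ = ⨆ R, ∫⁻ t, (B R).indicator h t ∂κ := by
    intro κ
    rw [← setLIntegral_univ, ← hBU, setLIntegral_iUnion_of_directed _ hBmono.directed_le]
    simp_rw [lintegral_indicator (hB _)]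
  ext A hA
  have hA1 := hXm ξ hA
  have hA2 := hadd hA
  -- For fixed `A` each side is the integral of `h` against a measure that does not depend on `h`,
  -- so monotone convergence removes the truncation.
  have e1 : ∀ {h : T → ℝ≥0∞}, Measurable h →
      (P.withDensity fun ω => ∫⁻ t, h t ∂(M (X.val ω))).map (X.pair ξ) A
        = ∫⁻ t, h t ∂((P.restrict (X.pair ξ ⁻¹' A)).bind fun ω => M (X.val ω)) := fun hh => by
    rw [Measure.map_apply (hXm ξ) hA, withDensity_apply _ hA1]
    exact (Measure.lintegral_bind (M.measurable.comp X.measurable_val).aemeasurable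
      hh.aemeasurable).symm
  have e2 : ∀ {h : T → ℝ≥0∞}, Measurable h → ∫⁻ t, h t ∂m ≠ ∞ →
      (P.prod (m.withDensity h)).map (fun p => X.pair ξ p.1 + Y.pair ξ p.2) A
        = ∫⁻ t, h t ∂(m.withDensity fun t => P {ω | X.pair ξ ω + Y.pair ξ t ∈ A}) :=
    fun {h} hh hfin => by
      obtain ⟨_, _⟩ := hfinite hh hfin
      have hPm : Measurable fun t => P {ω | X.pair ξ ω + Y.pair ξ t ∈ A} :=
        measurable_measure_prodMk_right hA2
      rw [Measure.map_apply hadd hA, Measure.prod_apply_symm hA2,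
        lintegral_withDensity_eq_lintegral_mul _ hPm hh, mul_comm]
      exact lintegral_withDensity_eq_lintegral_mul _ hh hPm
  rw [e1 hh, e2 hh hfin, hsup, hsup]
  refine iSup_congr fun R => ?_
  rw [← e1 (hh.indicator (hB R)), htrunc, e2 (hh.indicator (hB R))
    (ne_top_of_le_ne_top hfin (lintegral_mono (Set.indicator_le_self _ _)))]

/-- The law of `X + Y` is in fact the law of `X` under `P` reweighted by `∫ h dM(X)`. By Cramér–Wold
this reduces to single pairings. -/
theorem IsChaos.shift_absolutelyContinuous [IsProbabilityMeasure P] (hM : IsChaos X Y M)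
    (hX : IsStandardGaussian X)
    {h : T → ℝ≥0∞} (hh : Measurable h) (hfin : ∫⁻ t, h t ∂(expectedMeasure X M) ≠ ∞) :
    (P.prod ((expectedMeasure X M).withDensity h)).map (fun p => X.val p.1 + Y.val p.2)
      ≪ P.map X.val := by
  set m := (expectedMeasure X M).withDensity h with hm
  have hmμ : m ≪ μ := (withDensity_absolutelyContinuous _ _).trans hM.expected_ac
  set Q := P.withDensity fun ω => ∫⁻ t, h t ∂(M (X.val ω)) with hQ
  have : IsFiniteMeasure m := isFiniteMeasure_withDensity hfin
  have : IsFiniteMeasure Q :=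
    isFiniteMeasure_withDensity (by rwa [← lintegral_expectedMeasure hh])
  have hval := X.measurable_val
  have hYval := Y.measurable_val
  have hadd : Measurable fun p : Ω × T => X.val p.1 + Y.val p.2 := by fun_prop
  suffices H : (P.prod m).map (fun p => X.val p.1 + Y.val p.2) = Q.map X.val by
    rw [H]
    exact (withDensity_absolutelyContinuous _ _).map hval
  refine measure_ext_of_forall_sum fun I θ => ?_
  set η : H := ∑ i ∈ I, θ i • i with hη
  rw [Measure.map_map (by fun_prop) hadd, Measure.map_map (by fun_prop) hval]
  have e1 : (fun z : H → ℝ => ∑ i ∈ I, θ i * z i) ∘ (fun p : Ω × T => X.val p.1 + Y.val p.2)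
      =ᵐ[P.prod m] fun p => X.pair η p.1 + Y.pair η p.2 := by
    filter_upwards [Measure.quasiMeasurePreserving_fst.ae (X.pair_sum I θ fun i => i),
      Measure.quasiMeasurePreserving_snd.ae (hmμ.ae_le (Y.pair_sum I θ fun i => i))] with p h1 h2
    rw [h1, h2]
    simp [GenFun.val, mul_add, Finset.sum_add_distrib]
  have e2 : (fun z : H → ℝ => ∑ i ∈ I, θ i * z i) ∘ X.val =ᵐ[Q] X.pair η := by
    filter_upwards [(withDensity_absolutelyContinuous P _).ae_le (X.pair_sum I θ fun i => i)]
      with ω hω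
    exact hω.symm
  rw [Measure.map_congr e1, Measure.map_congr e2, hM.map_pair_eq hX hh hfin]

/-- In either case some finite measure equivalent to `μ` is admissible as the law of the shift. -/
theorem exists_equivalent_shift [IsProbabilityMeasure P] [IsProbabilityMeasure μ]
    (hX : IsStandardGaussian X)
    (hY : IsRandomizedShift X Y ∨
      ∃ M : Kernel (H → ℝ) T, IsSubcriticalChaos X Y M ∧ μ ≪ expectedMeasure X M) :
    ∃ m : Measure T, IsFiniteMeasure m ∧ m ≪ μ ∧ μ ≪ m ∧
      (P.prod m).map (fun p => X.val p.1 + Y.val p.2) ≪ P.map X.val := by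
  rcases hY with hY | ⟨M, hM, hac⟩
  · exact ⟨μ, inferInstance, .rfl, .rfl, hY⟩
  · have := hM.sigmaFinite
    obtain ⟨g, hg0, hg, hgfin⟩ :=
      exists_pos_lintegral_lt_of_sigmaFinite (expectedMeasure X M) one_ne_zero
    have hfin : ∫⁻ t, (g t : ℝ≥0∞) ∂(expectedMeasure X M) ≠ ∞ := (hgfin.trans ENNReal.one_lt_top).ne
    refine ⟨(expectedMeasure X M).withDensity fun t => (g t : ℝ≥0∞),
      isFiniteMeasure_withDensity hfin,
      (withDensity_absolutelyContinuous _ _).trans hM.expected_ac,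
      hac.trans (withDensity_absolutelyContinuous' hg.coe_nnreal_ennreal.aemeasurable ?_),
      hM.shift_absolutelyContinuous hX hg.coe_nnreal_ennreal hfin⟩
    exact ae_of_all _ fun t => by simpa using (hg0 t).ne'

end Chaos

/-! ### Basis independence of the Hilbert–Schmidt norm -/

section HilbertSchmidtBasis

variable {E : Type*} [NormedAddCommGroup E] [InnerProductSpace ℝ E]

/-- Parseval's identity for the Riesz vector of `ℓ`. The right side is free of `b`, so one slot of a
tensor can change basis. -/
theorem HilbertBasis.tsum_sq_apply [CompleteSpace E] {ι : Type*} (b : HilbertBasis ι ℝ E)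
    (ℓ : E →L[ℝ] ℝ) :
    ∑' i, ENNReal.ofReal (ℓ (b i) ^ 2) = ENNReal.ofReal (‖ℓ‖ ^ 2) := by
  obtain ⟨z, rfl⟩ := (InnerProductSpace.toDual ℝ E).surjective ℓ
  have h := b.hasSum_inner_mul_inner z z
  have h' : HasSum (fun i => (InnerProductSpace.toDual ℝ E z) (b i) ^ 2) (‖z‖ ^ 2) := by
    rw [← real_inner_self_eq_norm_sq]
    refine h.congr_fun fun i => ?_
    rw [InnerProductSpace.toDual_apply_apply, real_inner_comm z (b i), pow_two]
  rw [← ENNReal.ofReal_tsum_of_nonneg (fun i => sq_nonneg _) h'.summable, h'.tsum_eq]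
  simp

theorem tsum_sq_succ_eq {n : ℕ} (τ : ContinuousMultilinearMap ℝ (fun _ : Fin (n + 1) => E) ℝ)
    {κ : Type*} (c : κ → E) :
    ∑' s : Fin (n + 1) → κ, ENNReal.ofReal (τ (fun k => c (s k)) ^ 2)
      = ∑' i, ∑' s : Fin n → κ, ENNReal.ofReal (τ.curryLeft (c i) (fun k => c (s k)) ^ 2) := by
  rw [← (Fin.consEquiv fun _ : Fin (n + 1) => κ).tsum_eq, ENNReal.tsum_prod']
  refine tsum_congr fun i => tsum_congr fun s => ?_
  rw [ContinuousMultilinearMap.curryLeft_apply]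
  congr 3
  funext k
  refine Fin.cases ?_ (fun k => ?_) k <;> simp

/-- The Hilbert–Schmidt norm does not depend on the basis. -/
theorem tsum_sq_hilbertBasis_eq [CompleteSpace E] {ι ι' : Type*} (b : HilbertBasis ι ℝ E)
    (b' : HilbertBasis ι' ℝ E)
    {n : ℕ} (τ : ContinuousMultilinearMap ℝ (fun _ : Fin n => E) ℝ) :
    ∑' s : Fin n → ι, ENNReal.ofReal (τ (fun k => b (s k)) ^ 2)
      = ∑' s : Fin n → ι', ENNReal.ofReal (τ (fun k => b' (s k)) ^ 2) := by
  induction n with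
  | zero =>
    rw [tsum_eq_single default (fun s hs => absurd (Subsingleton.elim _ _) hs),
      tsum_eq_single default (fun s hs => absurd (Subsingleton.elim _ _) hs)]
    congr 3
    exact Subsingleton.elim _ _
  | succ n ih =>
    rw [tsum_sq_succ_eq, tsum_sq_succ_eq]
    -- Induction changes the basis in the last `n` slots with the first one fixed; after exchanging
    -- the sums, Parseval changes it in the first slot.
    simp_rw [ih]
    rw [ENNReal.tsum_comm, ENNReal.tsum_comm (f := fun i (s : Fin n → ι') => _)]
    refine tsum_congr fun s => ?_
    let ℓ : E →L[ℝ] ℝ :=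
      (ContinuousMultilinearMap.apply ℝ (fun _ : Fin n => E) ℝ fun k => b' (s k)).comp τ.curryLeft
    exact (HilbertBasis.tsum_sq_apply b ℓ).trans (HilbertBasis.tsum_sq_apply b' ℓ).symm

end HilbertSchmidtBasis

theorem isHilbertSchmidtTensor_of_summable {E : Type*} [NormedAddCommGroup E]
    [InnerProductSpace ℝ E] [CompleteSpace E] {ι : Type*} (b : HilbertBasis ι ℝ E) {n : ℕ}
    {τ : ContinuousMultilinearMap ℝ (fun _ : Fin n => E) ℝ}
    (h : Summable fun s : Fin n → ι => τ (fun k => b (s k)) ^ 2) : IsHilbertSchmidtTensor τ := by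
  intro ι' b'
  have h1 := h.tsum_ofReal_ne_top
  rw [tsum_sq_hilbertBasis_eq b b'] at h1
  refine (ENNReal.summable_toReal h1).congr fun s => ?_
  rw [ENNReal.toReal_ofReal (sq_nonneg _)]

/-! ### Moment tensors and passage to lower degrees -/

section Moments

theorem abs_prod_le_one_add_sum {n N : ℕ} (hn : n ≤ N) (a : Fin n → ℝ) :
    |∏ k, a k| ≤ 1 + ∑ k, |a k| ^ N := by
  rw [Finset.abs_prod]
  have hs : 0 ≤ ∑ k, |a k| ^ N := Finset.sum_nonneg fun _ _ => by positivity
  by_cases h1 : ∀ k, |a k| ≤ 1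
  · have := Finset.prod_le_one (s := Finset.univ) (fun k _ => abs_nonneg (a k)) fun k _ => h1 k
    linarith
  · push Not at h1
    obtain ⟨k0, hk0⟩ := h1
    obtain ⟨k, -, hk⟩ := Finset.exists_max_image Finset.univ (fun k => |a k|) ⟨k0, Finset.mem_univ _⟩
    have h2 : 1 ≤ |a k| := hk0.le.trans (hk k0 (Finset.mem_univ _))
    calc ∏ j, |a j| ≤ ∏ _j : Fin n, |a k| :=
          Finset.prod_le_prod (fun j _ => abs_nonneg _) fun j _ => hk j (Finset.mem_univ _)
      _ = |a k| ^ n := by simp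
      _ ≤ |a k| ^ N := pow_le_pow_right₀ h2 hn
      _ ≤ ∑ k, |a k| ^ N := Finset.single_le_sum (f := fun k => |a k| ^ N)
          (fun _ _ => by positivity) (Finset.mem_univ k)
      _ ≤ _ := by linarith

theorem abs_pow_le_one_add {n N : ℕ} (hn : n ≤ N) (x : ℝ) : |x| ^ n ≤ 1 + |x| ^ N := by
  rcases le_total |x| 1 with h | h
  · have := pow_le_one₀ (n := n) (abs_nonneg x) h
    have := pow_nonneg (abs_nonneg x) N
    linarith
  · have := pow_le_pow_right₀ h hn
    linarith

variable {T : Type*} [MeasurableSpace T] {ν : Measure T}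

theorem integrable_prod_of_pow [IsFiniteMeasure ν] {n N : ℕ} (hn : n ≤ N) {f : Fin n → T → ℝ}
    (hf : ∀ k, Measurable (f k)) (hint : ∀ k, Integrable (fun t => |f k t| ^ N) ν) :
    Integrable (fun t => ∏ k, f k t) ν := by
  refine Integrable.mono' ((integrable_const (1 : ℝ)).add
    (integrable_finsetSum Finset.univ fun k _ => hint k))
    (Finset.measurable_fun_prod _ fun k _ => hf k).aestronglyMeasurable (ae_of_all _ fun t => ?_)
  exact abs_prod_le_one_add_sum hn fun k => f k t

/-- The Hilbert–Schmidt sums of the moments are the moments of the covariance kernel. -/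
theorem sum_sq_integral_prod_eq [SFinite ν] {ι : Type*} [DecidableEq ι] (F : Finset ι) {n : ℕ}
    (y : ι → T → ℝ) (hint : ∀ s : Fin n → ι, Integrable (fun t => ∏ k, y (s k) t) ν) :
    Integrable (fun p : T × T => (∑ i ∈ F, y i p.1 * y i p.2) ^ n) (ν.prod ν) ∧
    ∫ p, (∑ i ∈ F, y i p.1 * y i p.2) ^ n ∂(ν.prod ν)
      = ∑ s ∈ Fintype.piFinset fun _ : Fin n => F, (∫ t, ∏ k, y (s k) t ∂ν) ^ 2 := by
  have hexp : ∀ p : T × T, (∑ i ∈ F, y i p.1 * y i p.2) ^ n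
      = ∑ s ∈ Fintype.piFinset fun _ : Fin n => F, (∏ k, y (s k) p.1) * ∏ k, y (s k) p.2 := by
    intro p
    have := Finset.prod_univ_sum (fun _ : Fin n => F) (fun _ i => y i p.1 * y i p.2)
    rw [Finset.prod_const, Finset.card_univ, Fintype.card_fin] at this
    rw [this]
    exact Finset.sum_congr rfl fun s _ => Finset.prod_mul_distrib
  simp_rw [hexp]
  refine ⟨integrable_finsetSum _ fun s _ => (hint s).mul_prod (hint s), ?_⟩
  rw [integral_finsetSum _ fun s _ => (hint s).mul_prod (hint s)]
  refine Finset.sum_congr rfl fun s _ => ?_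
  rw [integral_prod_mul (fun t => ∏ k, y (s k) t) (fun t => ∏ k, y (s k) t), pow_two]

/-- Square summability of the moments of even degree `N` gives it for all lower degrees. -/
theorem summable_sq_integral_prod_of_le [IsFiniteMeasure ν] {ι : Type*} {n N : ℕ} (hn : n ≤ N)
    (hN : Even N) {y : ι → T → ℝ} (hy : ∀ i, Measurable (y i))
    (hint : ∀ i, Integrable (fun t => |y i t| ^ N) ν)
    (hsum : Summable fun s : Fin N → ι => (∫ t, ∏ k, y (s k) t ∂ν) ^ 2) :
    Summable fun s : Fin n → ι => (∫ t, ∏ k, y (s k) t ∂ν) ^ 2 := by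
  classical
  refine summable_of_sum_le (c := (ν.prod ν).real Set.univ
    + ∑' s : Fin N → ι, (∫ t, ∏ k, y (s k) t ∂ν) ^ 2) (fun _ => sq_nonneg _) fun G => ?_
  -- Enlarging `G` to a cube `F^n` makes the sum the integral of the `n`-th power of a partial
  -- kernel, where `x^n ≤ 1 + x^N` applies pointwise.
  let F : Finset ι := G.biUnion fun s => Finset.univ.image s
  have hGF : G ⊆ Fintype.piFinset fun _ : Fin n => F := fun s hs => by
    rw [Fintype.mem_piFinset]
    exact fun k => Finset.mem_biUnion.2 ⟨s, hs, Finset.mem_image_of_mem _ (Finset.mem_univ k)⟩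
  obtain ⟨i1, e1⟩ := sum_sq_integral_prod_eq (ν := ν) F (n := n) y fun s =>
    integrable_prod_of_pow hn (fun k => hy _) fun k => hint _
  obtain ⟨i2, e2⟩ := sum_sq_integral_prod_eq (ν := ν) F (n := N) y fun s =>
    integrable_prod_of_pow le_rfl (fun k => hy _) fun k => hint _
  calc ∑ s ∈ G, (∫ t, ∏ k, y (s k) t ∂ν) ^ 2
      ≤ ∑ s ∈ Fintype.piFinset fun _ : Fin n => F, (∫ t, ∏ k, y (s k) t ∂ν) ^ 2 :=
        Finset.sum_le_sum_of_subset_of_nonneg hGF fun _ _ _ => sq_nonneg _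
    _ = ∫ p, (∑ i ∈ F, y i p.1 * y i p.2) ^ n ∂(ν.prod ν) := e1.symm
    _ ≤ ∫ p, (1 + (∑ i ∈ F, y i p.1 * y i p.2) ^ N) ∂(ν.prod ν) := by
        refine integral_mono i1 ((integrable_const 1).add i2) fun p => ?_
        have := abs_pow_le_one_add hn (∑ i ∈ F, y i p.1 * y i p.2)
        rw [hN.pow_abs, ← abs_pow] at this
        exact (le_abs_self _).trans this
    _ = (ν.prod ν).real Set.univ + ∑ s ∈ Fintype.piFinset fun _ : Fin N => F,
          (∫ t, ∏ k, y (s k) t ∂ν) ^ 2 := by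
        rw [integral_add (integrable_const 1) i2, e2]
        simp
    _ ≤ _ := by
        gcongr
        exact hsum.sum_le_tsum _ fun _ _ => sq_nonneg _

variable {H : Type*} [NormedAddCommGroup H] [InnerProductSpace ℝ H]
variable {μ : Measure T} {Y : GenFun H μ}

/-- The moment tensor of degree `n ≤ N` exists if the `N`-th absolute moments are bounded on the
unit ball. -/
theorem exists_moment_tensor [IsFiniteMeasure ν] (hν : ν ≪ μ) {N : ℕ} {C : ℝ}
    (hint : ∀ ξ : H, Integrable (fun t => |Y.pair ξ t| ^ N) ν)
    (hC : ∀ ξ : H, ‖ξ‖ ≤ 1 → ∫ t, |Y.pair ξ t| ^ N ∂ν ≤ C) {n : ℕ} (hn : n ≤ N) :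
    ∃ τ : ContinuousMultilinearMap ℝ (fun _ : Fin n => H) ℝ,
      ∀ ξ : Fin n → H, τ ξ = ∫ t, ∏ k, Y.pair (ξ k) t ∂ν := by
  have hprod : ∀ ξ : Fin n → H, Integrable (fun t => ∏ k, Y.pair (ξ k) t) ν := fun ξ =>
    integrable_prod_of_pow hn (fun k => Y.measurable_pair _) fun k => hint _
  let τ : MultilinearMap ℝ (fun _ : Fin n => H) ℝ :=
    { toFun := fun ξ => ∫ t, ∏ k, Y.pair (ξ k) t ∂ν
      map_update_add' := fun {_} ξ k x z => by
        rw [← integral_add (hprod _) (hprod _)]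
        refine integral_congr_ae ?_
        filter_upwards [hν.ae_le (Y.pair_add x z)] with t ht
        rw [← Finset.mul_prod_erase _ _ (Finset.mem_univ k),
          ← Finset.mul_prod_erase _ _ (Finset.mem_univ k),
          ← Finset.mul_prod_erase _ _ (Finset.mem_univ k)]
        simp only [Function.update_self]
        rw [ht, add_mul]
        congr 2 <;> refine Finset.prod_congr rfl fun j hj => ?_ <;>
          exact congrArg (fun w => Y.pair w t)
            ((Function.update_of_ne (Finset.ne_of_mem_erase hj) _ _).trans
              (Function.update_of_ne (Finset.ne_of_mem_erase hj) _ _).symm)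
      map_update_smul' := fun {_} ξ k c x => by
        rw [smul_eq_mul, ← integral_const_mul]
        refine integral_congr_ae ?_
        filter_upwards [hν.ae_le (Y.pair_smul c x)] with t ht
        rw [← Finset.mul_prod_erase _ _ (Finset.mem_univ k),
          ← Finset.mul_prod_erase _ _ (Finset.mem_univ k)]
        simp only [Function.update_self]
        rw [ht, mul_assoc]
        congr 2
        refine Finset.prod_congr rfl fun j hj => ?_
        exact congrArg (fun w => Y.pair w t)
          ((Function.update_of_ne (Finset.ne_of_mem_erase hj) _ _).trans
            (Function.update_of_ne (Finset.ne_of_mem_erase hj) _ _).symm) }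
  have hunit : ∀ ξ : Fin n → H, (∀ k, ‖ξ k‖ ≤ 1) → |τ ξ| ≤ ν.real Set.univ + n * C := by
    intro ξ hξ
    calc |∫ t, ∏ k, Y.pair (ξ k) t ∂ν| ≤ ∫ t, |∏ k, Y.pair (ξ k) t| ∂ν := abs_integral_le_integral_abs
      _ ≤ ∫ t, (1 + ∑ k, |Y.pair (ξ k) t| ^ N) ∂ν := by
          refine integral_mono (hprod ξ).abs ((integrable_const 1).add
            (integrable_finsetSum _ fun k _ => hint _)) fun t => ?_
          exact abs_prod_le_one_add_sum hn fun k => Y.pair (ξ k) t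
      _ = ν.real Set.univ + ∑ k, ∫ t, |Y.pair (ξ k) t| ^ N ∂ν := by
          rw [integral_add (integrable_const 1) (integrable_finsetSum _ fun k _ => hint _),
            integral_finsetSum _ fun k _ => hint _]
          simp
      _ ≤ ν.real Set.univ + ∑ _k : Fin n, C := by
          gcongr with k
          exact hC _ (hξ k)
      _ = _ := by simp
  refine ⟨τ.mkContinuous (ν.real Set.univ + n * C) fun ξ => ?_, fun ξ => rfl⟩
  have h1 : τ ξ = (∏ k, ‖ξ k‖) • τ fun k => ‖ξ k‖⁻¹ • ξ k := by
    rw [← τ.map_smul_univ]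
    congr 1
    funext k
    rcases eq_or_ne (ξ k) 0 with h | h
    · simp [h]
    · rw [smul_inv_smul₀ (norm_ne_zero_iff.2 h)]
  rw [h1, smul_eq_mul, norm_mul, Real.norm_of_nonneg (Finset.prod_nonneg fun _ _ => norm_nonneg _),
    mul_comm]
  refine mul_le_mul_of_nonneg_right (hunit _ fun k => ?_)
    (Finset.prod_nonneg fun _ _ => norm_nonneg _)
  rw [norm_smul, norm_inv, norm_norm]
  exact inv_mul_le_one

/-- Square summable moments of even degree `N` in one basis give Hilbert–Schmidt moment tensors of
all degrees `n ≤ N`. -/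
theorem hasHilbertSchmidtMoment_of_le [CompleteSpace H] [IsFiniteMeasure ν] (hν : ν ≪ μ) {N : ℕ}
    (hN : Even N) {C : ℝ} (hint : ∀ ξ : H, Integrable (fun t => |Y.pair ξ t| ^ N) ν)
    (hC : ∀ ξ : H, ‖ξ‖ ≤ 1 → ∫ t, |Y.pair ξ t| ^ N ∂ν ≤ C) {ι : Type*} (b : HilbertBasis ι ℝ H)
    (hsum : Summable fun s : Fin N → ι => (∫ t, ∏ k, Y.pair (b (s k)) t ∂ν) ^ 2)
    {n : ℕ} (hn : n ≤ N) : HasHilbertSchmidtMoment Y ν n := by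
  obtain ⟨τ, hτ⟩ := exists_moment_tensor hν hint hC hn
  refine ⟨fun ξ => ?_, τ, hτ, isHilbertSchmidtTensor_of_summable b ?_⟩
  · refine ((integrable_const (1 : ℝ)).add (hint ξ)).mono'
      ((Y.measurable_pair ξ).abs.pow_const n).aestronglyMeasurable (ae_of_all _ fun t => ?_)
    rw [Real.norm_of_nonneg (by positivity)]
    exact abs_pow_le_one_add hn _
  · simp_rw [hτ]
    exact summable_sq_integral_prod_of_le hn hN (y := fun i => Y.pair (b i))
      (fun i => Y.measurable_pair _) (fun i => hint _) hsum

end Moments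

/-! ### Square integrable kernels and uniqueness -/

section Kernels

variable {T : Type*} [MeasurableSpace T] {ν : Measure T}

theorem inner_Lp_eq (f g : Lp ℝ 2 ν) : inner ℝ f g = ∫ t, f t * g t ∂ν := by
  rw [L2.inner_def]
  refine integral_congr_ae (ae_of_all _ fun t => ?_)
  simp [mul_comm]

variable [IsFiniteMeasure ν]

theorem memLp_two_mul_prod {f g : T → ℝ} (hf : MemLp f 2 ν) (hg : MemLp g 2 ν) :
    MemLp (fun p : T × T => f p.1 * g p.2) 2 (ν.prod ν) := by
  refine (memLp_two_iff_integrable_sq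
    ((hf.comp_fst ν).aestronglyMeasurable.mul (hg.comp_snd ν).aestronglyMeasurable)).2 ?_
  refine (hf.integrable_sq.mul_prod hg.integrable_sq).congr (ae_of_all _ fun p => ?_)
  simp [mul_pow]

/-- The product kernel `(t, s) ↦ f t * g s`. -/
noncomputable def prodKernel (f g : Lp ℝ 2 ν) : Lp ℝ 2 (ν.prod ν) :=
  (memLp_two_mul_prod (Lp.memLp f) (Lp.memLp g)).toLp _

theorem coeFn_prodKernel (f g : Lp ℝ 2 ν) :
    prodKernel f g =ᵐ[ν.prod ν] fun p => f p.1 * g p.2 :=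
  MemLp.coeFn_toLp _

theorem inner_prodKernel (K : Lp ℝ 2 (ν.prod ν)) (f g : Lp ℝ 2 ν) :
    inner ℝ K (prodKernel f g) = ∫ p, K p * f p.1 * g p.2 ∂(ν.prod ν) := by
  rw [L2.inner_def]
  refine integral_congr_ae ?_
  filter_upwards [coeFn_prodKernel f g] with p hp
  rw [hp]
  simp only [RCLike.inner_apply, conj_trivial]
  ring

theorem inner_prodKernel_prodKernel (f g f' g' : Lp ℝ 2 ν) :
    inner ℝ (prodKernel f g) (prodKernel f' g') = inner ℝ f f' * inner ℝ g g' := by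
  rw [inner_prodKernel, inner_Lp_eq, inner_Lp_eq, ← integral_prod_mul]
  refine integral_congr_ae ?_
  filter_upwards [coeFn_prodKernel f g] with p hp
  rw [hp]
  ring

theorem prodKernel_add_add (f g f' g' : Lp ℝ 2 ν) :
    prodKernel (f + f') (g + g')
      = prodKernel f g + prodKernel f g' + prodKernel f' g + prodKernel f' g' := by
  refine Lp.ext ?_
  have h1 : ∀ᵐ p ∂(ν.prod ν), (f + f' : Lp ℝ 2 ν) p.1 = f p.1 + f' p.1 :=
    Measure.quasiMeasurePreserving_fst.ae (Lp.coeFn_add f f')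
  have h2 : ∀ᵐ p ∂(ν.prod ν), (g + g' : Lp ℝ 2 ν) p.2 = g p.2 + g' p.2 :=
    Measure.quasiMeasurePreserving_snd.ae (Lp.coeFn_add g g')
  filter_upwards [h1, h2, coeFn_prodKernel (f + f') (g + g'), coeFn_prodKernel f g,
    coeFn_prodKernel f g', coeFn_prodKernel f' g, coeFn_prodKernel f' g',
    Lp.coeFn_add (prodKernel f g + prodKernel f g' + prodKernel f' g) (prodKernel f' g'),
    Lp.coeFn_add (prodKernel f g + prodKernel f g') (prodKernel f' g),
    Lp.coeFn_add (prodKernel f g) (prodKernel f g')] with p a1 a2 a3 a4 a5 a6 a7 a8 a9 a10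
  rw [a3, a1, a2, a8, Pi.add_apply, a9, Pi.add_apply, a10, Pi.add_apply, a4, a5, a6, a7]
  ring

/-- A square integrable kernel is determined by its pairings with product kernels. -/
theorem Lp_prod_ext {K K' : Lp ℝ 2 (ν.prod ν)}
    (h : ∀ f g : Lp ℝ 2 ν, inner ℝ K (prodKernel f g) = inner ℝ K' (prodKernel f g)) : K = K' := by
  rw [← sub_eq_zero]
  set D := K - K' with hD
  have hint : Integrable D (ν.prod ν) := (Lp.memLp D).integrable one_le_two
  -- Indicators give vanishing integrals over rectangles, and a π-λ argument extends this to all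
  -- measurable sets.
  have hrect : ∀ A B : Set T, MeasurableSet A → MeasurableSet B →
      ∫ p in A ×ˢ B, D p ∂(ν.prod ν) = 0 := by
    intro A B hA hB
    have h1 : inner ℝ D (prodKernel (indicatorConstLp 2 hA (measure_ne_top ν A) (1 : ℝ))
        (indicatorConstLp 2 hB (measure_ne_top ν B) (1 : ℝ))) = 0 := by
      rw [hD, inner_sub_left, h, sub_self]
    rw [← h1, inner_prodKernel, ← integral_indicator (hA.prod hB)]
    refine integral_congr_ae ?_
    filter_upwards [Measure.quasiMeasurePreserving_fst.ae (indicatorConstLp_coeFn (p := 2)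
        (hs := hA) (hμs := measure_ne_top ν A) (c := (1 : ℝ))),
      Measure.quasiMeasurePreserving_snd.ae (indicatorConstLp_coeFn (p := 2)
        (hs := hB) (hμs := measure_ne_top ν B) (c := (1 : ℝ)))] with p h2 h3
    rw [h2, h3]
    by_cases hpA : p.1 ∈ A <;> by_cases hpB : p.2 ∈ B <;> simp [Set.indicator, hpA, hpB]
  have hall : ∀ s, MeasurableSet s → ∫ p in s, D p ∂(ν.prod ν) = 0 := by
    have huniv : ∫ p, D p ∂(ν.prod ν) = 0 := by
      simpa using hrect Set.univ Set.univ .univ .univ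
    intro s hs
    induction s, hs using MeasurableSpace.induction_on_inter generateFrom_prod.symm
      isPiSystem_prod with
    | empty => simp
    | basic s hs =>
      obtain ⟨A, hA, B, hB, rfl⟩ := hs
      exact hrect A B hA hB
    | compl s hs ih =>
      have := integral_add_compl hs hint
      rw [ih, huniv, zero_add] at this
      exact this
    | iUnion f hd hf ih =>
      rw [integral_iUnion hf hd hint.integrableOn]
      simp [ih]
  refine Lp.eq_zero_iff_ae_eq_zero.2 ?_
  exact hint.ae_eq_zero_of_forall_setIntegral_eq_zero fun s hs _ => hall s hs

/-- The kernel with its arguments exchanged. -/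
noncomputable def swapKernel (K : Lp ℝ 2 (ν.prod ν)) : Lp ℝ 2 (ν.prod ν) :=
  Lp.compMeasurePreserving Prod.swap Measure.measurePreserving_swap K

theorem inner_swapKernel (K : Lp ℝ 2 (ν.prod ν)) (f g : Lp ℝ 2 ν) :
    inner ℝ (swapKernel K) (prodKernel f g) = inner ℝ K (prodKernel g f) := by
  rw [inner_prodKernel, inner_prodKernel, ← integral_prod_swap]
  refine integral_congr_ae ?_
  have h := Measure.measurePreserving_swap.quasiMeasurePreserving.ae
    (Lp.coeFn_compMeasurePreserving K (Measure.measurePreserving_swap (μ := ν) (ν := ν)))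
  filter_upwards [h] with p hp
  simp only [Prod.fst_swap, Prod.snd_swap, swapKernel]
  rw [hp]
  simp only [Function.comp, Prod.swap_swap]
  ring

theorem symmetric_iff_swapKernel {K : Lp ℝ 2 (ν.prod ν)} :
    (∀ᵐ p ∂(ν.prod ν), K p.swap = K p) ↔ swapKernel K = K := by
  have h := Lp.coeFn_compMeasurePreserving K (Measure.measurePreserving_swap (μ := ν) (ν := ν))
  constructor
  · intro hK
    refine Lp.ext ?_
    filter_upwards [hK, h] with p h1 h2
    rw [← h1]
    exact h2
  · intro hK
    filter_upwards [h] with p h2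
    change swapKernel K p = _ at h2
    rw [hK] at h2
    exact h2.symm

/-- A symmetric kernel is determined by its quadratic form. -/
theorem IsSymmetricKernelOf.unique {q : Lp ℝ 2 ν → ℝ} {K K' : Lp ℝ 2 (ν.prod ν)}
    (hK : IsSymmetricKernelOf q K) (hK' : IsSymmetricKernelOf q K') : K' = K := by
  have hpol : ∀ {K : Lp ℝ 2 (ν.prod ν)}, IsSymmetricKernelOf q K → ∀ f g : Lp ℝ 2 ν,
      inner ℝ K (prodKernel f g) = (q (f + g) - q f - q g) / 2 := by
    intro K hK f g
    have hq : ∀ f, q f = inner ℝ K (prodKernel f f) := fun f => by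
      rw [hK.2, inner_prodKernel]
    have hsw : inner ℝ K (prodKernel g f) = inner ℝ K (prodKernel f g) := by
      rw [← inner_swapKernel, symmetric_iff_swapKernel.1 hK.1]
    rw [hq, hq f, hq g, prodKernel_add_add, inner_add_right, inner_add_right, inner_add_right, hsw]
    ring
  exact Lp_prod_ext fun f g => by rw [hpol hK, hpol hK']

end Kernels

/-! ### Summability from Gram matrices -/

section Summability

/-- Vectors with nonnegative summable Gram matrix are summable. -/
theorem summable_of_summable_inner {E : Type*} [NormedAddCommGroup E] [InnerProductSpace ℝ E]
    [CompleteSpace E] {ι : Type*} {v : ι → E}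
    (hs : Summable fun p : ι × ι => inner ℝ (v p.1) (v p.2)) : Summable v := by
  classical
  rw [summable_iff_vanishing_norm] at hs ⊢
  intro ε hε
  obtain ⟨S, hS⟩ := hs (ε ^ 2) (by positivity)
  refine ⟨S.image Prod.fst, fun t ht => ?_⟩
  have hd : Disjoint (t ×ˢ t) S := Finset.disjoint_left.2 fun p hp hpS =>
    Finset.disjoint_left.1 ht (Finset.mem_product.1 hp).1 (Finset.mem_image_of_mem _ hpS)
  have h1 := hS _ hd
  rw [Finset.sum_product] at h1
  have h2 : ∑ i ∈ t, ∑ j ∈ t, inner ℝ (v i) (v j) = ‖∑ i ∈ t, v i‖ ^ 2 := by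
    rw [← real_inner_self_eq_norm_sq, sum_inner]
    simp_rw [inner_sum]
  rw [h2, Real.norm_of_nonneg (sq_nonneg _)] at h1
  exact lt_of_pow_lt_pow_left₀ 2 hε.le h1

end Summability

/-! ### The covariance kernel -/

section Covariance

variable {T : Type*} [MeasurableSpace T] {ν : Measure T} [IsFiniteMeasure ν]
variable {H : Type*} [NormedAddCommGroup H] [InnerProductSpace ℝ H]

/-- If `A` has a kernel `K` then `f ↦ ‖A f‖²` is a Hilbert–Schmidt quadratic form. -/
theorem isHilbertSchmidtQuadraticForm_of_kernel {A : Lp ℝ 2 ν →L[ℝ] H} {K : Lp ℝ 2 (ν.prod ν)}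
    (hK : ∀ f g, inner ℝ K (prodKernel f g) = inner ℝ (A f) (A g)) :
    IsHilbertSchmidtQuadraticForm fun f : Lp ℝ 2 ν => ‖A f‖ ^ 2 := by
  let B : Lp ℝ 2 ν →L[ℝ] Lp ℝ 2 ν →L[ℝ] ℝ := LinearMap.mkContinuous₂
    (LinearMap.mk₂ ℝ (fun f g => inner ℝ (A f) (A g))
      (fun f f' g => by rw [map_add, inner_add_left])
      (fun c f g => by rw [map_smul, real_inner_smul_left, smul_eq_mul])
      (fun f g g' => by rw [map_add, inner_add_right])
      (fun c f g => by rw [map_smul, real_inner_smul_right, smul_eq_mul])) (‖A‖ * ‖A‖)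
    (fun f g => by
      refine (norm_inner_le_norm (A f) (A g)).trans ?_
      calc ‖A f‖ * ‖A g‖ ≤ (‖A‖ * ‖f‖) * (‖A‖ * ‖g‖) :=
            mul_le_mul (A.le_opNorm f) (A.le_opNorm g) (norm_nonneg _) (by positivity)
        _ = _ := by ring)
  have hB : ∀ f g, B f g = inner ℝ (A f) (A g) := fun f g => rfl
  refine ⟨B, fun f g => ?_, fun f => ?_, fun ι b => ?_⟩
  · rw [hB, hB, real_inner_comm]
  · rw [hB, real_inner_self_eq_norm_sq]
  · classical
    -- The coefficients of `B` are those of `K` along an orthonormal family of product kernels, so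
    -- Bessel's inequality applies.
    have hon : Orthonormal ℝ fun p : ι × ι => prodKernel (b p.1) (b p.2) := by
      rw [orthonormal_iff_ite]
      intro p r
      rw [inner_prodKernel_prodKernel, orthonormal_iff_ite.1 b.orthonormal,
        orthonormal_iff_ite.1 b.orthonormal]
      by_cases h1 : p.1 = r.1 <;> by_cases h2 : p.2 = r.2 <;> simp [Prod.ext_iff, h1, h2]
    refine (hon.inner_products_summable (x := K)).congr fun p => ?_
    rw [hB, ← hK, real_inner_comm, Real.norm_eq_abs, sq_abs]

variable {μ : Measure T} {Y : GenFun H μ}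

/-- The covariance kernel, given Hilbert–Schmidt second moments and square summable moments of an
even degree `N`. -/
theorem hasCovarianceKernel_of_moments [CompleteSpace H] (hν : ν ≪ μ)
    (h2 : HasHilbertSchmidtMoment Y ν 2) {N : ℕ}
    (hN : Even N) (hint : ∀ ξ : H, Integrable (fun t => |Y.pair ξ t| ^ N) ν)
    {ι : Type*} [Countable ι] (b : HilbertBasis ι ℝ H)
    (hsum2 : Summable fun s : Fin 2 → ι => (∫ t, ∏ k, Y.pair (b (s k)) t ∂ν) ^ 2)
    (hsum : Summable fun s : Fin N → ι => (∫ t, ∏ k, Y.pair (b (s k)) t ∂ν) ^ 2)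
    {n : ℕ} (hn : n ≤ N) : HasCovarianceKernel Y ν n := by
  classical
  obtain ⟨hint2, τ, hτ, -⟩ := h2
  have hmem : ∀ ξ, MemLp (Y.pair ξ) 2 ν := fun ξ =>
    (memLp_two_iff_integrable_sq (Y.measurable_pair ξ).aestronglyMeasurable).2
      (by simpa using hint2 ξ)
  let S0 : H →ₗ[ℝ] Lp ℝ 2 ν :=
    { toFun := fun ξ => (hmem ξ).toLp _
      map_add' := fun ξ η => by
        rw [← MemLp.toLp_add]
        exact MemLp.toLp_congr _ _ (hν.ae_le (Y.pair_add ξ η))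
      map_smul' := fun c ξ => by
        rw [RingHom.id_apply, ← MemLp.toLp_const_smul]
        exact MemLp.toLp_congr _ _ (hν.ae_le (Y.pair_smul c ξ)) }
  have hS0 : ∀ ξ, S0 ξ =ᵐ[ν] Y.pair ξ := fun ξ => (hmem ξ).coeFn_toLp
  have hS0inner : ∀ ξ η, inner ℝ (S0 ξ) (S0 η) = ∫ t, Y.pair ξ t * Y.pair η t ∂ν := by
    intro ξ η
    rw [inner_Lp_eq]
    refine integral_congr_ae ?_
    filter_upwards [hS0 ξ, hS0 η] with t h1 h2
    rw [h1, h2]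
  have hS0norm : ∀ ξ, ‖S0 ξ‖ ≤ √‖τ‖ * ‖ξ‖ := by
    intro ξ
    have h1 : ‖S0 ξ‖ ^ 2 ≤ ‖τ‖ * ‖ξ‖ ^ 2 := by
      rw [← real_inner_self_eq_norm_sq, hS0inner]
      have h3 := hτ fun _ => ξ
      have h4 := τ.le_opNorm fun _ => ξ
      simp only [Fin.prod_univ_two] at h3 h4
      rw [← h3, pow_two ‖ξ‖]
      exact (le_abs_self _).trans h4
    refine le_of_sq_le_sq ?_ (by positivity)
    rw [mul_pow, Real.sq_sqrt (norm_nonneg _)]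
    exact h1
  -- The second moment tensor makes `ξ ↦ ⟨Y, ξ⟩` bounded into `L²(ν)`; its adjoint is the weak
  -- integral.
  let S : H →L[ℝ] Lp ℝ 2 ν := S0.mkContinuous (√‖τ‖) hS0norm
  have hS : ∀ ξ, S ξ = S0 ξ := fun ξ => rfl
  let A : Lp ℝ 2 ν →L[ℝ] H := S.adjoint
  have hA : ∀ f ξ, inner ℝ (A f) ξ = inner ℝ f (S ξ) := fun f ξ => S.adjoint_inner_left ξ f
  have hweak : ∀ f : Lp ℝ 2 ν, IsWeakIntegral Y ν f (A f) := by
    intro f ξ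
    refine ⟨(Lp.memLp f).integrable_mul (hmem ξ), ?_⟩
    rw [hA, inner_Lp_eq]
    refine integral_congr_ae ?_
    filter_upwards [hS0 ξ] with t ht
    rw [hS, ht]
  -- The Gram entries of these rank-one kernels are `(∫ y_i y_j dν)²`, nonnegative and summable by
  -- `hsum2`, so the series for `K` converges in `L²`.
  let v : ι → Lp ℝ 2 (ν.prod ν) := fun i => prodKernel (S (b i)) (S (b i))
  have hv : Summable v := by
    refine summable_of_summable_inner ?_
    have h3 := (finTwoArrowEquiv ι).symm.summable_iff.2 hsum2
    refine h3.congr fun p => ?_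
    rw [inner_prodKernel_prodKernel, hS, hS, hS0inner]
    simp [pow_two]
  let K : Lp ℝ 2 (ν.prod ν) := ∑' i, v i
  have hK : ∀ f g, inner ℝ K (prodKernel f g) = inner ℝ (A f) (A g) := by
    intro f g
    have h3 := (hv.hasSum.mapL (innerSL ℝ (prodKernel f g)))
    have h4 := b.hasSum_inner_mul_inner (A f) (A g)
    rw [real_inner_comm]
    refine h3.unique (h4.congr_fun fun i => ?_)
    rw [hA, real_inner_comm (A g), hA, innerSL_apply_apply, inner_prodKernel_prodKernel]
  have hsymm : ∀ᵐ p ∂(ν.prod ν), K p.swap = K p :=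
    symmetric_iff_swapKernel.2 (Lp_prod_ext fun f g => by
      rw [inner_swapKernel, hK, hK, real_inner_comm])
  have hker : IsSymmetricKernelOf (fun f : Lp ℝ 2 ν => ‖A f‖ ^ 2) K :=
    ⟨hsymm, fun f => by rw [← inner_prodKernel, hK, real_inner_self_eq_norm_sq]⟩
  refine ⟨A, hweak, isHilbertSchmidtQuadraticForm_of_kernel hK, K, hker,
    fun K' hK' => hker.unique hK', ?_⟩
  have hKm : Measurable fun p => K p := (Lp.stronglyMeasurable K).measurable
  -- The `N`-th powers of the partial sums integrate to partial Hilbert–Schmidt sums; Fatou along an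
  -- almost everywhere convergent subsequence does the rest.
  have hKN : Integrable (fun p => K p ^ N) (ν.prod ν) := by
    obtain ⟨G, -, hG⟩ := exists_seq_monotone_tendsto_atTop_atTop (Finset ι)
    obtain ⟨ns, -, hns⟩ :=
      (tendstoInMeasure_of_tendsto_Lp (hv.hasSum.comp hG)).exists_seq_tendsto_ae
    have hcoe : ∀ F : Finset ι, ∀ᵐ p ∂(ν.prod ν),
        (∑ i ∈ F, v i : Lp ℝ 2 (ν.prod ν)) p = ∑ i ∈ F, Y.pair (b i) p.1 * Y.pair (b i) p.2 := by
      intro F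
      have h3 : ∀ᵐ p ∂(ν.prod ν), ∀ i, v i p = Y.pair (b i) p.1 * Y.pair (b i) p.2 := by
        refine ae_all_iff.2 fun i => ?_
        filter_upwards [coeFn_prodKernel (S (b i)) (S (b i)),
          Measure.quasiMeasurePreserving_fst.ae (hS0 (b i)),
          Measure.quasiMeasurePreserving_snd.ae (hS0 (b i))] with p h4 h5 h6
        rw [h4, hS, h5, h6]
      filter_upwards [h3, Lp.coeFn_fun_finsetSum F v] with p h4 h5
      rw [h5]
      exact Finset.sum_congr rfl fun i _ => h4 i
    have hbound : ∀ F : Finset ι,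
        ∫⁻ p, ENNReal.ofReal ((∑ i ∈ F, v i : Lp ℝ 2 (ν.prod ν)) p ^ N) ∂(ν.prod ν)
          ≤ ENNReal.ofReal (∑' s : Fin N → ι, (∫ t, ∏ k, Y.pair (b (s k)) t ∂ν) ^ 2) := by
      intro F
      obtain ⟨i1, e1⟩ := sum_sq_integral_prod_eq (ν := ν) F (n := N) (fun i => Y.pair (b i))
        fun s => integrable_prod_of_pow le_rfl (fun k => Y.measurable_pair _) fun k => hint _
      have h3 : ∫⁻ p, ENNReal.ofReal ((∑ i ∈ F, v i : Lp ℝ 2 (ν.prod ν)) p ^ N) ∂(ν.prod ν)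
          = ∫⁻ p, ENNReal.ofReal ((∑ i ∈ F, Y.pair (b i) p.1 * Y.pair (b i) p.2) ^ N)
            ∂(ν.prod ν) := by
        refine lintegral_congr_ae ?_
        filter_upwards [hcoe F] with p hp
        rw [hp]
      rw [h3, ← ofReal_integral_eq_lintegral_ofReal i1 (ae_of_all _ fun p => hN.pow_nonneg _), e1]
      exact ENNReal.ofReal_le_ofReal (hsum.sum_le_tsum _ fun _ _ => sq_nonneg _)
    refine ⟨(hKm.pow_const N).aestronglyMeasurable, ?_⟩
    rw [hasFiniteIntegral_iff_ofReal (ae_of_all _ fun p => hN.pow_nonneg _)]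
    refine lt_of_le_of_lt ?_ (ENNReal.ofReal_lt_top
      (r := ∑' s : Fin N → ι, (∫ t, ∏ k, Y.pair (b (s k)) t ∂ν) ^ 2))
    calc ∫⁻ p, ENNReal.ofReal (K p ^ N) ∂(ν.prod ν)
        = ∫⁻ p, liminf (fun k => ENNReal.ofReal
            ((∑ i ∈ G (ns k), v i : Lp ℝ 2 (ν.prod ν)) p ^ N)) atTop ∂(ν.prod ν) := by
          refine lintegral_congr_ae ?_
          filter_upwards [hns] with p hp
          exact ((ENNReal.continuous_ofReal.tendsto _).comp (hp.pow N)).liminf_eq.symm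
      _ ≤ liminf (fun k => ∫⁻ p, ENNReal.ofReal
            ((∑ i ∈ G (ns k), v i : Lp ℝ 2 (ν.prod ν)) p ^ N) ∂(ν.prod ν)) atTop :=
          lintegral_liminf_le fun k =>
            ((Lp.stronglyMeasurable _).measurable.pow_const N).ennreal_ofReal
      _ ≤ _ := liminf_le_of_frequently_le' (Frequently.of_forall fun k => hbound _)
  refine ((integrable_const (1 : ℝ)).add hKN).mono' (hKm.pow_const n).aestronglyMeasurable
    (ae_of_all _ fun p => ?_)
  have h3 := abs_pow_le_one_add hn (K p)
  rw [hN.pow_abs] at h3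
  rw [norm_pow]
  exact h3

end Covariance

/-- Distinct members are at distance `√2`, so balls of radius `1/2` around them are disjoint. -/
theorem Orthonormal.countable {H : Type*} [NormedAddCommGroup H] [InnerProductSpace ℝ H]
    [TopologicalSpace.SeparableSpace H] {ι : Type*} {b : ι → H} (hb : Orthonormal ℝ b) :
    Countable ι := by
  refine Pairwise.countable_of_isOpen_disjoint (s := fun i => Metric.ball (b i) (1 / 2)) ?_
    (fun i => Metric.isOpen_ball) fun i => Metric.nonempty_ball.2 (by norm_num)
  intro i j hij
  refine Metric.ball_disjoint_ball ?_
  have h1 : ‖b i - b j‖ ^ 2 = 2 := by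
    rw [norm_sub_sq_real, hb.1, hb.1, hb.2 hij]
    norm_num
  rw [dist_eq_norm]
  nlinarith [norm_nonneg (b i - b j)]

/-! ### Equivalence under positive densities -/

section Density

variable {T : Type*} [MeasurableSpace T] {m : Measure T} {g : T → ℝ}

theorem withDensity_ofReal_le (h1 : ∀ t, g t ≤ 1) :
    m.withDensity (fun t => ENNReal.ofReal (g t)) ≤ m := by
  conv_rhs => rw [← withDensity_one (μ := m)]
  exact withDensity_mono (ae_of_all _ fun t => by simpa using h1 t)

theorem absolutelyContinuous_withDensity_ofReal (hg : Measurable g) (hpos : ∀ᵐ t ∂m, 0 < g t) :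
    m ≪ m.withDensity fun t => ENNReal.ofReal (g t) :=
  withDensity_absolutelyContinuous' hg.ennreal_ofReal.aemeasurable
    (by filter_upwards [hpos] with t ht; simpa using ht)

end Density

/-! ### From moments in one basis to all the properties -/

section Moments

variable {T : Type*} [MeasurableSpace T] {μ ν : Measure T} [IsFiniteMeasure ν]
variable {H : Type*} [NormedAddCommGroup H] [InnerProductSpace ℝ H]
variable {Y : GenFun H μ}

/-- Square summable moments of even degree in one basis bound the moments in all directions. -/
theorem lintegral_pow_pair_le (hν : ν ≪ μ) {N : ℕ} (hN : Even N) {ι : Type*} [Countable ι]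
    (b : HilbertBasis ι ℝ H) (hint : ∀ i, Integrable (fun t => |Y.pair (b i) t| ^ N) ν)
    (hsum : Summable fun s : Fin N → ι => (∫ t, ∏ k, Y.pair (b (s k)) t ∂ν) ^ 2) (ξ : H) :
    ∫⁻ t, ENNReal.ofReal (Y.pair ξ t ^ N) ∂ν ≤ ENNReal.ofReal
      (√((‖ξ‖ ^ 2) ^ N) * √(∑' s : Fin N → ι, (∫ t, ∏ k, Y.pair (b (s k)) t ∂ν) ^ 2)) := by
  classical
  set Q := ∑' s : Fin N → ι, (∫ t, ∏ k, Y.pair (b (s k)) t ∂ν) ^ 2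
  let c : ι → ℝ := fun i => inner ℝ (b i) ξ
  let η : Finset ι → H := fun F => ∑ i ∈ F, c i • b i
  have hη : Tendsto η atTop (𝓝 ξ) := by
    have := b.hasSum_repr ξ
    simp_rw [b.repr_apply_apply] at this
    exact this
  have hpart : ∀ F, ∫⁻ t, ENNReal.ofReal (Y.pair (η F) t ^ N) ∂ν
      ≤ ENNReal.ofReal (√((‖ξ‖ ^ 2) ^ N) * √Q) := by
    intro F
    have hprod : ∀ s : Fin N → ι, Integrable (fun t => ∏ k, Y.pair (b (s k)) t) ν := fun s =>
      integrable_prod_of_pow le_rfl (fun k => Y.measurable_pair _) fun k => hint _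
    have hexp : ∀ t, (∑ i ∈ F, c i * Y.pair (b i) t) ^ N
        = ∑ s ∈ Fintype.piFinset fun _ : Fin N => F,
            (∏ k, c (s k)) * ∏ k, Y.pair (b (s k)) t := by
      intro t
      have := Finset.prod_univ_sum (fun _ : Fin N => F) (fun _ i => c i * Y.pair (b i) t)
      rw [Finset.prod_const, Finset.card_univ, Fintype.card_fin] at this
      rw [this]
      exact Finset.sum_congr rfl fun s _ => Finset.prod_mul_distrib
    have hi : Integrable (fun t => (∑ i ∈ F, c i * Y.pair (b i) t) ^ N) ν := by
      simp_rw [hexp]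
      exact integrable_finsetSum _ fun s _ => (hprod s).const_mul _
    have h1 : ∫⁻ t, ENNReal.ofReal (Y.pair (η F) t ^ N) ∂ν
        = ENNReal.ofReal (∫ t, (∑ i ∈ F, c i * Y.pair (b i) t) ^ N ∂ν) := by
      rw [ofReal_integral_eq_lintegral_ofReal hi (ae_of_all _ fun t => hN.pow_nonneg _)]
      refine lintegral_congr_ae ?_
      filter_upwards [hν.ae_le (Y.pair_sum F c b)] with t ht
      rw [ht]
    rw [h1]
    refine ENNReal.ofReal_le_ofReal ?_
    simp_rw [hexp]
    rw [integral_finsetSum _ fun s _ => (hprod s).const_mul _]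
    simp_rw [integral_const_mul]
    -- Cauchy–Schwarz between the coefficients of `ξ^{⊗N}` and the moments; Bessel bounds the former
    -- by `‖ξ‖^N`.
    refine (Real.sum_mul_le_sqrt_mul_sqrt _ _ _).trans ?_
    gcongr
    · have h2 := Finset.prod_univ_sum (fun _ : Fin N => F) (fun _ i => c i ^ 2)
      rw [Finset.prod_const, Finset.card_univ, Fintype.card_fin] at h2
      simp_rw [← Finset.prod_pow]
      rw [← h2]
      refine pow_le_pow_left₀ (Finset.sum_nonneg fun _ _ => sq_nonneg _) ?_ N
      have h3 := b.orthonormal.sum_inner_products_le ξ (s := F)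
      simpa only [Real.norm_eq_abs, sq_abs] using h3
    · exact hsum.sum_le_tsum _ fun _ _ => sq_nonneg _
  obtain ⟨G, -, hG⟩ := exists_seq_monotone_tendsto_atTop_atTop (Finset ι)
  -- Continuity in measure yields an almost everywhere convergent subsequence of `⟨Y, η (G k)⟩`, so
  -- Fatou passes the uniform bound to `ξ`.
  have hmeas : TendstoInMeasure μ (fun (k : ℕ) (t : T) => Y.op (η (G k)) t) atTop
      (fun t => Y.op ξ t) := fun ε hε =>
    (Y.continuous_in_measure ξ ε hε).comp (hη.comp hG)
  obtain ⟨ns, -, hns⟩ := hmeas.exists_seq_tendsto_ae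
  calc ∫⁻ t, ENNReal.ofReal (Y.pair ξ t ^ N) ∂ν
      = ∫⁻ t, liminf (fun k => ENNReal.ofReal (Y.pair (η (G (ns k))) t ^ N)) atTop ∂ν := by
        refine lintegral_congr_ae ?_
        filter_upwards [hν.ae_le hns] with t ht
        exact ((ENNReal.continuous_ofReal.tendsto _).comp (ht.pow N)).liminf_eq.symm
    _ ≤ liminf (fun k => ∫⁻ t, ENNReal.ofReal (Y.pair (η (G (ns k))) t ^ N) ∂ν) atTop :=
        lintegral_liminf_le fun k => ((Y.measurable_pair _).pow_const N).ennreal_ofReal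
    _ ≤ _ := liminf_le_of_frequently_le' (Frequently.of_forall fun k => hpart _)

variable [CompleteSpace H]

theorem hasMoment_and_hasCovarianceKernel (hν : ν ≪ μ) {N : ℕ} (hN : Even N) (h2N : 2 ≤ N)
    {C : ℝ} (hint : ∀ ξ : H, Integrable (fun t => |Y.pair ξ t| ^ N) ν)
    (hC : ∀ ξ : H, ‖ξ‖ ≤ 1 → ∫ t, |Y.pair ξ t| ^ N ∂ν ≤ C)
    {ι : Type*} [Countable ι] (b : HilbertBasis ι ℝ H)
    (hsum : Summable fun s : Fin N → ι => (∫ t, ∏ k, Y.pair (b (s k)) t ∂ν) ^ 2)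
    {n : ℕ} (hn : n ≤ N) : HasHilbertSchmidtMoment Y ν n ∧ HasCovarianceKernel Y ν n :=
  ⟨hasHilbertSchmidtMoment_of_le hν hN hint hC b hsum hn,
    hasCovarianceKernel_of_moments hν (hasHilbertSchmidtMoment_of_le hν hN hint hC b hsum h2N)
      hN hint b
      (summable_sq_integral_prod_of_le h2N hN (y := fun i => Y.pair (b i))
        (fun _ => Y.measurable_pair _) (fun _ => hint _) hsum) hsum hn⟩

/-- For even `n` the absolute moment of `⟨Y, ξ⟩` is the diagonal of the moment tensor, hence at most
`‖τ‖` on the unit ball. A nonzero even `n` is at least 2, so second moments are available. -/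
theorem HasHilbertSchmidtMoment.hasCovarianceKernel [TopologicalSpace.SeparableSpace H]
    (hν : ν ≪ μ) {n : ℕ} (h0 : n ≠ 0) (hn : Even n) (h : HasHilbertSchmidtMoment Y ν n) :
    HasCovarianceKernel Y ν n := by
  obtain ⟨hint, τ, hτ, hHS⟩ := h
  obtain ⟨S, b, -⟩ := exists_hilbertBasis ℝ H
  have := Orthonormal.countable b.orthonormal
  have h2 : 2 ≤ n := by
    obtain ⟨k, rfl⟩ := hn
    omega
  refine (hasMoment_and_hasCovarianceKernel hν hn h2 (C := ‖τ‖) hint (fun ξ hξ => ?_) b ?_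
    le_rfl).2
  · have h3 := hτ fun _ => ξ
    have h4 := τ.le_opNorm fun _ => ξ
    simp only [Finset.prod_const, Finset.card_univ, Fintype.card_fin] at h3 h4
    simp_rw [hn.pow_abs]
    rw [← h3]
    refine (le_abs_self _).trans (h4.trans ?_)
    exact mul_le_of_le_one_right (norm_nonneg _) (pow_le_one₀ (norm_nonneg _) hξ)
  · have := hHS S b
    simp_rw [hτ] at this
    exact this

end Moments

/-! ### Choice of the equivalent probability measure -/

section Main

variable {H : Type*} [NormedAddCommGroup H] [InnerProductSpace ℝ H]
variable {Ω : Type*} [MeasurableSpace Ω] {P : Measure Ω} [IsProbabilityMeasure P]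
variable {T : Type*} [MeasurableSpace T] {μ : Measure T}
variable {X : GenFun H P} {Y : GenFun H μ}

/-- Tightness of the homogeneous polynomials of a randomized shift. -/
theorem tight_prod_pair (hX : IsStandardGaussian X) {m : Measure T} [IsFiniteMeasure m]
    (hm : (P.prod m).map (fun p => X.val p.1 + Y.val p.2) ≪ P.map X.val)
    {ι : Type*} {b : ι → H} (hb : Orthonormal ℝ b) {N : ℕ} (hN : N ≠ 0) {ε : ℝ≥0∞} (hε : ε ≠ 0) :
    ∃ R : ℝ, ∀ (G : Finset (Fin N → ι)) (a : (Fin N → ι) → ℝ), ∑ s ∈ G, a s ^ 2 ≤ 1 →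
      m {t | R < ∑ s ∈ G, a s * ∏ k, Y.pair (b (s k)) t} ≤ ε := by
  let r : (H → ℝ) → ι → ℝ := fun z i => z (b i)
  have hr : Measurable r := by fun_prop
  have hXv := X.measurable_val
  have hYv := Y.measurable_val
  have hx : Measurable fun ω i => X.pair (b i) ω := hr.comp hXv
  have hy : Measurable fun t i => Y.pair (b i) t := hr.comp hYv
  have hac : ((P.map fun ω i => X.pair (b i) ω).prod (m.map fun t i => Y.pair (b i) t)).map
      (fun p => p.1 + p.2) ≪ P.map fun ω i => X.pair (b i) ω := by
    have h1 := hm.map hr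
    rw [Measure.map_map hr hXv, Measure.map_map hr (by fun_prop)] at h1
    rw [Measure.map_prod_map _ _ hx hy, Measure.map_map (by fun_prop) (hx.prodMap hy)]
    exact h1
  obtain ⟨R, hR⟩ := (isStandard_map_pair hX hb).tight_of_shift hN hac hε
  refine ⟨R, fun G a ha => le_trans ?_ (hR G a ha)⟩
  rw [Measure.map_apply hy (measurableSet_lt measurable_const (by fun_prop))]
  exact measure_mono fun t (ht : R < _) => lt_of_lt_of_le ht (le_abs_self _)

/-- An equivalent probability measure with square summable moments of degree `N`. -/
theorem exists_equivalent_summable_moments [IsProbabilityMeasure μ] (hX : IsStandardGaussian X)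
    {m : Measure T} [IsFiniteMeasure m] (hmμ : m ≪ μ) (hμm : μ ≪ m)
    (hm : (P.prod m).map (fun p => X.val p.1 + Y.val p.2) ≪ P.map X.val)
    {ι : Type*} [Countable ι] {b : ι → H} (hb : Orthonormal ℝ b) {N : ℕ} (hN : N ≠ 0) :
    ∃ ν : Measure T, IsProbabilityMeasure ν ∧ ν ≪ μ ∧ μ ≪ ν ∧
      (∀ i, Integrable (fun t => |Y.pair (b i) t| ^ N) ν) ∧
      Summable fun s : Fin N → ι => (∫ t, ∏ k, Y.pair (b (s k)) t ∂ν) ^ 2 := by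
  let φ : (Fin N → ι) → T → ℝ := fun s t => ∏ k, Y.pair (b (s k)) t
  have hφ : ∀ s, Measurable (φ s) := fun s => Finset.measurable_fun_prod _ fun k _ =>
    Y.measurable_pair _
  -- A first density makes every monomial square integrable. It is at most 1, so tightness persists
  -- for the second density `w`, which makes the moments square summable.
  obtain ⟨g, hg, -, hg1, hgpos, hgint⟩ := exists_density_integrable (m := m)
    (f := fun s t => φ s t ^ 2) fun s => (hφ s).pow_const 2
  set m₁ := m.withDensity fun t => ENNReal.ofReal (g t) with hm₁
  have hm₁le : m₁ ≤ m := withDensity_ofReal_le hg1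
  have : IsFiniteMeasure m₁ := isFiniteMeasure_of_le m hm₁le
  have hφ2 : ∀ s, MemLp (φ s) 2 m₁ := by
    intro s
    rw [memLp_two_iff_integrable_sq (hφ s).aestronglyMeasurable, hm₁,
      integrable_withDensity_iff hg.ennreal_ofReal (ae_of_all _ fun _ => ENNReal.ofReal_lt_top)]
    refine (hgint s).congr ?_
    filter_upwards [hgpos] with t ht
    rw [ENNReal.toReal_ofReal ht.le]
  obtain ⟨w, hw, hw0, hw1, hwpos, hwsum⟩ := exists_weight_summable_sq hφ hφ2 fun ε hε => by
    obtain ⟨R, hR⟩ := tight_prod_pair hX hm hb hN hε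
    exact ⟨R, fun G a ha => (hm₁le _).trans (hR G a ha)⟩
  set m₂ := m₁.withDensity fun t => ENNReal.ofReal (w t) with hm₂
  have hm₂le : m₂ ≤ m₁ := withDensity_ofReal_le hw1
  have : IsFiniteMeasure m₂ := isFiniteMeasure_of_le m₁ hm₂le
  have hμm₂ : μ ≪ m₂ := hμm.trans ((absolutelyContinuous_withDensity_ofReal hg hgpos).trans
    (absolutelyContinuous_withDensity_ofReal hw hwpos))
  have hm₂μ : m₂ ≪ μ := (hm₂le.trans hm₁le).absolutelyContinuous.trans hmμ
  have hne : NeZero m₂ := ⟨fun h => by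
    have h1 : μ Set.univ = 0 := hμm₂ (by simp [h])
    simp at h1⟩
  have hc0 : (m₂ Set.univ)⁻¹ ≠ 0 := ENNReal.inv_ne_zero.2 (measure_ne_top _ _)
  refine ⟨(m₂ Set.univ)⁻¹ • m₂, isProbabilityMeasureSMul, ?_, ?_, fun i => ?_, ?_⟩
  · exact Measure.smul_absolutelyContinuous.trans hm₂μ
  · exact hμm₂.trans (Measure.absolutelyContinuous_smul hc0)
  · refine Integrable.smul_measure ?_ (ENNReal.inv_ne_top.2 (NeZero.ne _))
    -- The constant multi-index `(i, …, i)` gives the monomial `y_i^N`.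
    have h1 := ((hφ2 fun _ => i).integrable one_le_two).abs.mono_measure hm₂le
    refine h1.congr (ae_of_all _ fun t => ?_)
    simp [φ, abs_pow]
  · refine (hwsum.mul_left ((m₂ Set.univ)⁻¹.toReal ^ 2)).congr fun s => ?_
    rw [integral_smul_measure, smul_eq_mul, mul_pow, hm₂,
      integral_withDensity_eq_integral_toReal_smul hw.ennreal_ofReal
        (ae_of_all _ fun _ => ENNReal.ofReal_lt_top)]
    congr 2
    refine integral_congr_ae (ae_of_all _ fun t => ?_)
    simp only [φ, ENNReal.toReal_ofReal (hw0 t), smul_eq_mul, mul_comm]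

end Main

end GMC

theorem mainTheorem5
    {H : Type*} [NormedAddCommGroup H] [InnerProductSpace ℝ H] [CompleteSpace H]
    [TopologicalSpace.SeparableSpace H]
    {Ω : Type*} [MeasurableSpace Ω] [StandardBorelSpace Ω] (P : Measure Ω)
    [IsProbabilityMeasure P]
    {T : Type*} [MeasurableSpace T] [StandardBorelSpace T] (μ : Measure T)
    [IsProbabilityMeasure μ]
    (X : GMC.GenFun H P) (hX : GMC.IsStandardGaussian X)
    (Y : GMC.GenFun H μ)
    (hY : GMC.IsRandomizedShift X Y ∨
      ∃ M : Kernel (H → ℝ) T, GMC.IsSubcriticalChaos X Y M ∧ μ ≪ GMC.expectedMeasure X M)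
    (n : ℕ) :
    (∃ ν : Measure T, IsProbabilityMeasure ν ∧ ν ≪ μ ∧ μ ≪ ν ∧
      GMC.HasHilbertSchmidtMoment Y ν n ∧ GMC.HasCovarianceKernel Y ν n) ∧
    (n ≠ 0 → Even n → ∀ ν : Measure T, IsFiniteMeasure ν → ν ≪ μ → μ ≪ ν →
      GMC.HasHilbertSchmidtMoment Y ν n → GMC.HasCovarianceKernel Y ν n) := by
  refine ⟨?_, fun h0 hn ν _ hνμ _ h => h.hasCovarianceKernel hνμ h0 hn⟩
  obtain ⟨m, _, hmμ, hμm, hm⟩ := GMC.exists_equivalent_shift hX hY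
  obtain ⟨S, b, -⟩ := exists_hilbertBasis ℝ H
  have := GMC.Orthonormal.countable b.orthonormal
  -- This degree is even, at least 2 and at least `n`, whatever the parity of `n` and also for `n =
  -- 0`.
  have hN : Even (2 * n + 2) := ⟨n + 1, by ring⟩
  obtain ⟨ν, _, hνμ, hμν, hint, hsum⟩ := GMC.exists_equivalent_summable_moments hX hmμ hμm hm
    b.orthonormal (N := 2 * n + 2) (by omega)
  set Q := ∑' s : Fin (2 * n + 2) → S, (∫ t, ∏ k, Y.pair (b (s k)) t ∂ν) ^ 2
  have hle := GMC.lintegral_pow_pair_le hνμ hN b hint hsum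
  have hint' : ∀ ξ : H, Integrable (fun t => |Y.pair ξ t| ^ (2 * n + 2)) ν := fun ξ => by
    simp_rw [hN.pow_abs]
    refine ⟨((Y.measurable_pair ξ).pow_const _).aestronglyMeasurable, ?_⟩
    rw [hasFiniteIntegral_iff_ofReal (ae_of_all _ fun t => hN.pow_nonneg _)]
    exact (hle ξ).trans_lt ENNReal.ofReal_lt_top
  refine ⟨ν, inferInstance, hνμ, hμν, GMC.hasMoment_and_hasCovarianceKernel hνμ hN (by omega)
    (C := √Q) hint' (fun ξ hξ => ?_) b hsum (by omega)⟩
  have h1 := hint' ξ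
  simp_rw [hN.pow_abs] at h1 ⊢
  have h2 := hle ξ
  rw [← ofReal_integral_eq_lintegral_ofReal h1 (ae_of_all _ fun t => hN.pow_nonneg _),
    ENNReal.ofReal_le_ofReal_iff (by positivity)] at h2
  refine h2.trans (mul_le_of_le_one_left (Real.sqrt_nonneg _) ?_)
  rw [Real.sqrt_le_one]
  exact pow_le_one₀ (sq_nonneg _) (pow_le_one₀ (norm_nonneg _) hξ)
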